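/- **Theorem 1.2.** Let $\mathbf H$ be a complex Hilbert space and assume the following. * (H1) $A$ is a bounded self-adjoint operator on $\mathbf H$; $\mathbf V\subsetneq\mathbf H$ is a proper closed subspace with $\dim\mathbf V^\perp<\infty$; $B:\mathbf H\times\mathbf H\to\mathbf V$ is bilinear, symmetric and continuous, and $Q(u)=B(u,u)$. * (H3) $u^+,u^-\in\mathbf H$ satisfy $Q(u^\pm)=0$, and for each sign the derivative $T=Q'(u^\pm)$ satisfies the Kawashima condition: $T$ is self-adjoint with $\ker T=\mathbf V^\perp$; there is $\delta>0$ with $T_{|\mathbf V}\le-\delta I_{\mathbf V}$; there are a bounded skew-symmetric operator $K$ on $\mathbf H$ and $\gamma>0$ with $\mathrm{Re}\,(KA-T)\ge\gamma I$. * (H4) $A$ is one-to-one. * (H5) $A_{11}=P_{\mathbf V^\perp}A_{|\mathbf V^\perp}$ is invertible on $\mathbf V^\perp$. Write $A=\begin{bmatrix}A_{11}&A_{12}\\A_{21}&A_{22}\end{bmatrix}$ and $Q'(u^\pm)=\begin{bmatrix}0&0\\0&Q'_{22}(u^\pm)\end{bmatrix}$ with respect to $\mathbf H=\mathbf V^\perp\oplus\mathbf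 V$, and put $\tilde A=A_{22}-A_{21}A_{11}^{-1}A_{12}$. For bounded operators $\Gamma,E$ on a Hilbert space $\mathbf X$, $\Gamma$ one-to-one, $\Gamma^{-1}E$ denotes the operator with domain $\{u: Eu\in\mathrm{im}\,\Gamma\}$. Put $S^\eta_\pm=A^{-1}(Q'(u^\pm)\pm\eta A)$ on $\mathbf H$ and $S^{\mathrm r}_\pm=\tilde A^{-1}Q'_{22}(u^\pm)$ on $\mathbf V$. An operator $S$ generates an exponentially stable bi-semigroup on $\mathbf X$ if $\mathbf X=\mathbf X_1\oplus\mathbf X_2$ with closed subspaces invariant under $S$, $\mathrm{dom}\,S=(\mathrm{dom}\,S\cap\mathbf X_1)\oplus(\mathrm{dom}\,S\cap\mathbf X_2)$, and $S_{|\mathbf X_1}$ and $-S_{|\mathbf X_2}$ generate $C^0$-semigroups $T_1,T_2$ on $\mathbf X_1,\mathbf X_2$ with $\|T_j(\tau)\|\le Me^{-\nu\tau}$ for all $\tau\ge0$, for some $M$ and some $\nu>0$. A solution of $\Gamma u'=Eu$ on an interval $J$ is a continuous $u:J\to\mathbf X$ that is differentiable and satisfies the equation in the interior of $J$; a mild solution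 on $J$ is a continuous $u:J\to\mathbf X$ such that $\Gamma u$ is differentiable on $J$ with $(\Gamma u)'=Eu$. "The solution with $u(0)=u_0$" means a solution with which every mild solution with the same value at $0$ coincides on $J$. The equation has an exponential dichotomy on $\mathbf X$ if there are a bounded projection $P$ and constants $M$, $\nu>0$ such that for every $u_0\in\mathrm{im}\,P$ the solution on $\mathbb R_+$ with $u(0)=u_0$ exists, stays in $\mathrm{im}\,P$ and satisfies $\|u(\tau)\|\le Me^{-\nu\tau}\|u_0\|$ for $\tau\ge 0$, and for every $u_0\in\ker P$ the solution on $\mathbb R_-$ with $u(0)=u_0$ exists, stays in $\ker P$ and satisfies $\|u(\tau)\|\le Me^{\nu\tau}\|u_0\|$ for $\tau\le 0$. Then there is $\eta^*>0$ such that the following hold for both signs (with the same choice of sign throughout). 1. For every $\eta\in(0,\eta^*)$, $S^\eta_\pm$ generates an exponentially stable bi-semigroup on $\mathbf H$. 2. $\tilde A$ is one-to-one, and $S^{\mathrm r}_\pm$ generates an exponentially stable bi-semigroup on $\mathbf V$. 3. For every $\eta\in(0,\eta^*)$, the equation $Au'=(Q'(u^\pm)\pm\eta A)u$ has an exponential dichotomy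 on $\mathbf H$. 4. There are closed subspaces $\mathbf H^{\mathrm s}_\pm,\mathbf H^{\mathrm u}_\pm$ with $\mathbf H=\mathbf V^\perp\oplus\mathbf H^{\mathrm s}_\pm\oplus\mathbf H^{\mathrm u}_\pm$ and constants $M$, $\nu>0$ such that: for $u_0\in\mathbf V^\perp$ the constant function $u(\tau)=u_0$ is the solution of $Au'=Q'(u^\pm)u$ on $\mathbb R$ with $u(0)=u_0$; for $u_0\in\mathbf H^{\mathrm s}_\pm$ the solution of $Au'=Q'(u^\pm)u$ on $\mathbb R_+$ with $u(0)=u_0$ exists and satisfies $\|u(\tau)\|\le Me^{-\nu\tau}\|u_0\|$ for $\tau\ge0$; for $u_0\in\mathbf H^{\mathrm u}_\pm$ the solution on $\mathbb R_-$ with $u(0)=u_0$ exists and satisfies $\|u(\tau)\|\le Me^{\nu\tau}\|u_0\|$ for $\tau\le0$. -/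

import Mathlib

open Set Filter Topology

noncomputable section

/-! ### Operators of the form `Γ⁻¹ E` -/

section General

variable {X : Type*} [NormedAddCommGroup X] [NormedSpace ℂ X]

/-- The (in general unbounded) operator `Γ⁻¹ E` attached to two bounded operators, with `Γ`
one-to-one: its graph is the set of all pairs `(u, w)` with `Γ w = E u`, so that its domain is
`{u | E u ∈ range Γ}`. -/
def invMulOp (Γ E : X →L[ℂ] X) : X →ₗ.[ℂ] X :=
  Submodule.toLinearPMap
    (LinearMap.ker ((Γ : X →ₗ[ℂ] X) ∘ₗ LinearMap.snd ℂ X X - (E : X →ₗ[ℂ] X) ∘ₗ LinearMap.fst ℂ X X))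

/-- The part of an operator `S` in a subspace `Y`: its graph consists of the pairs in the graph of
`S` both of whose entries lie in `Y`. If `Y` is invariant under `S` this is the restriction of `S`
to `Y`, with domain `dom S ∩ Y`. -/
def partIn (S : X →ₗ.[ℂ] X) (Y : Submodule ℂ X) : Y →ₗ.[ℂ] Y :=
  Submodule.toLinearPMap (S.graph.comap (Y.subtype.prodMap Y.subtype))

/-! ### Semigroups and bi-semigroups -/

/-- A `C⁰`-semigroup of bounded operators `T(τ)`, `τ ≥ 0` (values at `τ < 0` are irrelevant). -/
structure C0Semigroup (X : Type*) [NormedAddCommGroup X] [NormedSpace ℂ X] where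
  /-- the operators of the semigroup -/
  op : ℝ → X →L[ℂ] X
  op_zero : op 0 = ContinuousLinearMap.id ℂ X
  op_add : ∀ s t : ℝ, 0 ≤ s → 0 ≤ t → op (s + t) = (op s).comp (op t)
  continuousOn_op : ∀ x : X, ContinuousOn (fun t => op t x) (Ici 0)

/-- `G` is the infinitesimal generator of `T`: `x` lies in the domain of `G` and `G x = y` if and
only if `(T(h) x - x) / h → y` as `h → 0+`. -/
def C0Semigroup.IsGenerator (T : C0Semigroup X) (G : X →ₗ.[ℂ] X) : Prop :=
  ∀ x y : X, (x, y) ∈ G.graph ↔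
    Tendsto (fun h : ℝ => h⁻¹ • (T.op h x - x)) (𝓝[>] 0) (𝓝 y)

/-- `‖T(τ)‖ ≤ M e^{-ντ}` for all `τ ≥ 0`, for some `M` and some `ν > 0`. -/
def C0Semigroup.ExpStable (T : C0Semigroup X) : Prop :=
  ∃ M ν : ℝ, 0 < ν ∧ ∀ τ : ℝ, 0 ≤ τ → ‖T.op τ‖ ≤ M * Real.exp (-ν * τ)

/-- A bi-semigroup on `X`: a decomposition of `X` into a direct sum of two closed subspaces and a
`C⁰`-semigroup on each of them. -/
structure BiSemigroup (X : Type*) [NormedAddCommGroup X] [NormedSpace ℂ X] where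
  /-- the first subspace -/
  fst : Submodule ℂ X
  /-- the second subspace -/
  snd : Submodule ℂ X
  isClosed_fst : IsClosed (fst : Set X)
  isClosed_snd : IsClosed (snd : Set X)
  isCompl : IsCompl fst snd
  /-- the semigroup on the first subspace -/
  semigroupFst : C0Semigroup fst
  /-- the semigroup on the second subspace -/
  semigroupSnd : C0Semigroup snd

/-- The operator `S` generates the bi-semigroup `b`: both subspaces of `b` are invariant under `S`,
the domain of `S` is the sum of its intersections with them, the restriction of `S` to the first
one generates the first semigroup, and the restriction of `-S` to the second one generates the
second semigroup. -/
structure BiSemigroup.IsGeneratedBy (b : BiSemigroup X) (S : X →ₗ.[ℂ] X) : Prop where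
  invariant_fst : ∀ x : S.domain, (x : X) ∈ b.fst → S x ∈ b.fst
  invariant_snd : ∀ x : S.domain, (x : X) ∈ b.snd → S x ∈ b.snd
  domain_le : S.domain ≤ (S.domain ⊓ b.fst) ⊔ (S.domain ⊓ b.snd)
  generator_fst : b.semigroupFst.IsGenerator (partIn S b.fst)
  generator_snd : b.semigroupSnd.IsGenerator (-partIn S b.snd)

/-- Both semigroups of the bi-semigroup are exponentially stable. -/
def BiSemigroup.ExpStable (b : BiSemigroup X) : Prop :=
  b.semigroupFst.ExpStable ∧ b.semigroupSnd.ExpStable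

/-! ### Solutions of `Γ u' = E u` and exponential dichotomies -/

/-- `u` is a classical solution of `Γ u' = E u` on the interval `J`: it is continuous on `J`, and
in the interior of `J` it is differentiable and satisfies the equation. -/
def IsSolutionOn (Γ E : X →L[ℂ] X) (J : Set ℝ) (u : ℝ → X) : Prop :=
  ContinuousOn u J ∧ ∀ t ∈ interior J, ∃ d : X, HasDerivAt u d t ∧ Γ d = E (u t)

/-- `u` is a mild solution of `Γ u' = E u` on the interval `J`: it is continuous on `J`, and `Γ u`
(but not necessarily `u`) is differentiable on `J`, with derivative `E u`. By the fundamental theorem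
of calculus this is the integrated equation `Γ u(b) - Γ u(a) = ∫_a^b E u(s) ds`, `a, b ∈ J`. -/
def IsMildSolutionOn (Γ E : X →L[ℂ] X) (J : Set ℝ) (u : ℝ → X) : Prop :=
  ContinuousOn u J ∧ ∀ t ∈ J, HasDerivWithinAt (fun s => Γ (u s)) (E (u t)) J t

/-- `u` is the solution of `Γ u' = E u` on the interval `J` with `u(0) = u₀`: it is a classical
solution, and every mild solution on `J` with the same value at `0` coincides with it on `J`. -/
structure IsTheSolutionOn (Γ E : X →L[ℂ] X) (J : Set ℝ) (u₀ : X) (u : ℝ → X) : Prop where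
  isSolution : IsSolutionOn Γ E J u
  initial : u 0 = u₀
  unique : ∀ w : ℝ → X, IsMildSolutionOn Γ E J w → w 0 = u₀ → EqOn w u J

/-- The equation `Γ u' = E u` has an exponential dichotomy on `X`: there is a bounded projection `P`
such that for data in the range of `P` the equation has a solution on `[0, ∞)`, which stays in the
range of `P` and decays exponentially, and for data in the kernel of `P` it has a solution on
`(-∞, 0]`, which stays in the kernel of `P` and decays exponentially at `-∞`. -/
def HasExponentialDichotomy (Γ E : X →L[ℂ] X) : Prop :=
  ∃ (P : X →L[ℂ] X) (M ν : ℝ), P.comp P = P ∧ 0 < ν ∧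
    (∀ u₀ : X, P u₀ = u₀ → ∃ u : ℝ → X, IsTheSolutionOn Γ E (Ici 0) u₀ u ∧
      ∀ τ : ℝ, 0 ≤ τ → P (u τ) = u τ ∧ ‖u τ‖ ≤ M * Real.exp (-ν * τ) * ‖u₀‖) ∧
    (∀ u₀ : X, P u₀ = 0 → ∃ u : ℝ → X, IsTheSolutionOn Γ E (Iic 0) u₀ u ∧
      ∀ τ : ℝ, τ ≤ 0 → P (u τ) = 0 ∧ ‖u τ‖ ≤ M * Real.exp (ν * τ) * ‖u₀‖)

/-- Decomposition of `X` into a given center subspace `C` and closed stable and unstable subspaces for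
the equation `Γ u' = E u`: `X = C ⊕ Xs ⊕ Xu`, data in `C` give constant solutions, data in `Xs` give
solutions on `[0, ∞)` decaying exponentially at `+∞`, and data in `Xu` give solutions on `(-∞, 0]`
decaying exponentially at `-∞`. -/
def HasCenterStableUnstableDecomposition (Γ E : X →L[ℂ] X) (C : Submodule ℂ X) : Prop :=
  ∃ Xs Xu : Submodule ℂ X, IsClosed (Xs : Set X) ∧ IsClosed (Xu : Set X) ∧
    DirectSum.IsInternal ![C, Xs, Xu] ∧
    (∀ u₀ ∈ C, IsTheSolutionOn Γ E univ u₀ (fun _ => u₀)) ∧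
    ∃ M ν : ℝ, 0 < ν ∧
      (∀ u₀ ∈ Xs, ∃ u : ℝ → X, IsTheSolutionOn Γ E (Ici 0) u₀ u ∧
        ∀ τ : ℝ, 0 ≤ τ → ‖u τ‖ ≤ M * Real.exp (-ν * τ) * ‖u₀‖) ∧
      (∀ u₀ ∈ Xu, ∃ u : ℝ → X, IsTheSolutionOn Γ E (Iic 0) u₀ u ∧
        ∀ τ : ℝ, τ ≤ 0 → ‖u τ‖ ≤ M * Real.exp (ν * τ) * ‖u₀‖)

end General

/-! ### The operators of the relaxation system -/

section Hilbert

variable {H : Type*} [NormedAddCommGroup H] [InnerProductSpace ℂ H] [CompleteSpace H]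

/-- The block `P_Z ∘ T|_Y : Y → Z` of a bounded operator `T` on `H`, where `P_Z` is the orthogonal
projection onto the closed subspace `Z`. -/
def opBlock (Y Z : Submodule ℂ H) [Z.HasOrthogonalProjection] (T : H →L[ℂ] H) : Y →L[ℂ] Z :=
  (Z.orthogonalProjectionOnto.comp T).comp Y.subtypeL

/-- The operator `Ã = A₂₂ - A₂₁ A₁₁⁻¹ A₁₂` on `V`, where the `A_{ij}` are the blocks of `A` in the
decomposition `H = Vᗮ ⊕ V` (meaningful if `A₁₁` is invertible). -/
def reducedOp (V : Submodule ℂ H) [CompleteSpace V] (A : H →L[ℂ] H) : V →L[ℂ] V :=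
  opBlock V V A -
    (opBlock Vᗮ V A).comp ((Ring.inverse (opBlock Vᗮ Vᗮ A)).comp (opBlock V Vᗮ A))

/-- The quadratic map `Q(u) = B(u, u)` of a bilinear map `B : H × H → V`, as a map into `H`. -/
def quadMap {V : Submodule ℂ H} (B : H →L[ℂ] H →L[ℂ] V) (u : H) : H := (B u u : H)

/-- The Kawashima condition for a bounded operator `T`, relative to `A` and `V`: `T` is self-adjoint
with kernel `Vᗮ`, `T|_V ≤ -δ` for some `δ > 0`, and `Re (K A - T) ≥ γ` for some bounded skew-symmetric
operator `K` on `H` and some `γ > 0`. -/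
structure KawashimaCondition (V : Submodule ℂ H) (A T : H →L[ℂ] H) : Prop where
  isSelfAdjoint : IsSelfAdjoint T
  ker_eq : LinearMap.ker (T : H →ₗ[ℂ] H) = Vᗮ
  negative : ∃ δ : ℝ, 0 < δ ∧ ∀ v ∈ V, (inner ℂ (T v) v).re ≤ -δ * ‖v‖ ^ 2
  compensator : ∃ K : H →L[ℂ] H, ContinuousLinearMap.adjoint K = -K ∧ ∃ γ : ℝ, 0 < γ ∧
    ∀ u : H, γ * ‖u‖ ^ 2 ≤ (inner ℂ ((K.comp A - T) u) u).re

end Hilbert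

end

/-!
For each sign put `T = Q'(u)`. Only three facts about `T` matter: it is self-adjoint, its kernel is
`Vᗮ`, and it is uniformly negative on `V`.

Since `T` vanishes on `Vᗮ` and maps into `V`, block elimination with the invertible `A₁₁` reduces the
pencil `(A, T)` to the pencil `(Ã, T₂₂)` on `V` (`KawashimaCondition.reduction`): a solution is
determined by its component `v` in `V` through `u = v - A₁₁⁻¹ A₁₂ v`, up to an equilibrium in `Vᗮ`.
The operator `Ã` is self-adjoint and one-to-one, because it represents the form of `A` on the graph of
`-A₁₁⁻¹ A₁₂`. As `T₂₂` is uniformly negative, `T₂₂ = -D²` with an invertible self-adjoint `D`, and in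
the variable `y = D v` the equation `Ã v' = T₂₂ v` becomes `G y' = -y` with the bounded self-adjoint
one-to-one operator `G = D⁻¹ Ã D⁻¹` (`exists_reduction_of_negative`).

The last equation is solved by the continuous functional calculus of `G`
(`isPropagator_posSemigroup`). For `t > 0` the function equal to `e^{-t/x}` for `x > 0` and to `0` for
`x ≤ 0` is continuous, bounded by `e^{-t/(‖G‖ + 1)}` on the spectrum, and differentiable in `t` uniformly
in `x`; this gives a semigroup with differentiable orbits on the closure of the range of the positive
part of `G`. The operator `-G` gives the semigroup backward in time, and as `G` is one-to-one the two
closures are complementary (`posProj_add_posProj_neg`). Mild solutions are unique in both directions,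
without any growth condition (`mildUnique_of_isSelfAdjoint`): a spectral cut-off away from `0` turns the
equation into an ordinary differential equation with a bounded coefficient.

The full equation thus has a trichotomy (`PencilReduction.isTrichotomy`): equilibria `Vᗮ`, a stable
space and an unstable space. The equation with `T ± ηA` in place of `T` arises by the substitution
`u ↦ e^{±ηt} u`, which moves the equilibria to the unstable or to the stable side and perturbs the
rates of the other two parts by `η` (`IsTrichotomy.shift_add`, `IsTrichotomy.shift_sub`).
-/

noncomputable section

/-! ### Propagators of a pencil -/

section Propagator

variable {X : Type*} [NormedAddCommGroup X] [NormedSpace ℂ X]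

/-- `U` is a one-sided propagator of the equation `Γ u' = E u` on the range of the projection
`P = U 0`, with exponential rate `ν` (decay if `ν > 0`). All operators are defined on the whole
space and vanish on `ker P`; values of `U` at negative times are irrelevant. Orbits need only be
differentiable at positive times, and `intertwines` says that `U` commutes with `Γ⁻¹ E`. -/
structure IsPropagator (Γ E P : X →L[ℂ] X) (ν : ℝ) (U : ℝ → X →L[ℂ] X) : Prop where
  zero : U 0 = P
  add : ∀ s t : ℝ, 0 ≤ s → 0 ≤ t → U (s + t) = (U s).comp (U t)
  cont : ∀ x, ContinuousOn (fun t => U t x) (Ici 0)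
  bound : ∃ M, ∀ t, 0 ≤ t → ‖U t‖ ≤ M * Real.exp (-ν * t)
  intertwines : ∀ t, 0 ≤ t → ∀ x y, Γ y = E x → Γ (U t y) = E (U t x)
  deriv : ∀ t, 0 < t → ∀ x, ∃ d, HasDerivAt (fun s => U s x) d t ∧ Γ d = E (U t x)

/-- Forward and backward uniqueness: a mild solution of `Γ u' = E u` on an interval containing `0`
vanishes if it vanishes at `0`. -/
def MildUnique (Γ E : X →L[ℂ] X) : Prop :=
  ∀ J : Set ℝ, Convex ℝ J → 0 ∈ J → ∀ w : ℝ → X, IsMildSolutionOn Γ E J w → w 0 = 0 →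
    ∀ t ∈ J, w t = 0

theorem eq_of_hasDerivWithinAt_zero {J : Set ℝ} (hJ : Convex ℝ J) (h0 : (0 : ℝ) ∈ J)
    {f : ℝ → X} (hf : ∀ t ∈ J, HasDerivWithinAt f 0 J t) {t : ℝ} (ht : t ∈ J) : f t = f 0 := by
  have := hJ.norm_image_sub_le_of_norm_hasDerivWithin_le (f' := fun _ => (0 : X)) (C := 0) hf
    (by simp) h0 ht
  simpa [sub_eq_zero] using this

namespace IsPropagator

variable {Γ E P P' : X →L[ℂ] X} {ν : ℝ} {U U' : ℝ → X →L[ℂ] X}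

theorem apply_zero (h : IsPropagator Γ E P ν U) (x : X) : U 0 x = P x := by rw [h.zero]

theorem add_apply (h : IsPropagator Γ E P ν U) {s t : ℝ} (hs : 0 ≤ s) (ht : 0 ≤ t) (x : X) :
    U (s + t) x = U s (U t x) := by rw [h.add s t hs ht]; rfl

theorem proj_apply (h : IsPropagator Γ E P ν U) {t : ℝ} (ht : 0 ≤ t) (x : X) :
    P (U t x) = U t x := by
  rw [← h.apply_zero, ← h.add_apply le_rfl ht, zero_add]

theorem apply_proj (h : IsPropagator Γ E P ν U) {t : ℝ} (ht : 0 ≤ t) (x : X) :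
    U t (P x) = U t x := by
  rw [← h.apply_zero, ← h.add_apply ht le_rfl, add_zero]

theorem proj_comp (h : IsPropagator Γ E P ν U) : P.comp P = P := by
  ext x
  simpa [h.apply_zero] using h.proj_apply le_rfl x

theorem exists_bound (h : IsPropagator Γ E P ν U) :
    ∃ M, 0 ≤ M ∧ ∀ t, 0 ≤ t → ‖U t‖ ≤ M * Real.exp (-ν * t) := by
  obtain ⟨M, hM⟩ := h.bound
  exact ⟨M, (norm_nonneg _).trans (by simpa using hM 0 le_rfl), hM⟩

theorem proj_intertwines (h : IsPropagator Γ E P ν U) {x y : X} (hxy : Γ y = E x) :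
    Γ (P y) = E (P x) := by
  simpa [h.apply_zero] using h.intertwines 0 le_rfl x y hxy

/-- Up to and including the initial time, orbits of a propagator are mild solutions. -/
theorem hasDerivWithinAt (h : IsPropagator Γ E P ν U) (x : X) {t : ℝ} (ht : 0 ≤ t) :
    HasDerivWithinAt (fun s => Γ (U s x)) (E (U t x)) (Ici 0) t := by
  have hpos : ∀ s, 0 < s → HasDerivAt (fun s => Γ (U s x)) (E (U s x)) s := fun s hs => by
    obtain ⟨d, hd, he⟩ := h.deriv s hs x
    rw [← he]
    exact (Γ.restrictScalars ℝ).hasFDerivAt.comp_hasDerivAt s hd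
  rcases ht.eq_or_lt with rfl | ht
  · refine hasDerivWithinAt_Ici_of_tendsto_deriv (s := Ioi 0)
      (fun s hs => (hpos s hs).differentiableAt.differentiableWithinAt)
      (Γ.continuous.continuousAt.comp_continuousWithinAt
        ((h.cont x 0 self_mem_Ici).mono Ioi_subset_Ici_self)) self_mem_nhdsWithin ?_
    have : Tendsto (fun s => E (U s x)) (𝓝[>] 0) (𝓝 (E (U 0 x))) :=
      E.continuous.continuousAt.comp_continuousWithinAt
        ((h.cont x 0 self_mem_Ici).mono Ioi_subset_Ici_self)
    refine this.congr' ?_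
    filter_upwards [self_mem_nhdsWithin] with s hs
    exact (hpos s hs).deriv.symm
  · exact (hpos t ht).hasDerivWithinAt

/-- If `Γ y = E x`, then the orbit of `x` is differentiable up to the initial time, with the orbit
of `y` as its derivative. -/
theorem hasDerivWithinAt_of_eq (h : IsPropagator Γ E P ν U) (hΓ : Function.Injective Γ) {x y : X}
    (hxy : Γ y = E x) : HasDerivWithinAt (fun s => U s x) (P y) (Ici 0) 0 := by
  have hpos : ∀ s, 0 < s → HasDerivAt (fun s => U s x) (U s y) s := fun s hs => by
    obtain ⟨d, hd, he⟩ := h.deriv s hs x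
    rw [← h.intertwines s hs.le x y hxy, hΓ.eq_iff] at he
    exact he ▸ hd
  refine hasDerivWithinAt_Ici_of_tendsto_deriv (s := Ioi 0)
      (fun s hs => (hpos s hs).differentiableAt.differentiableWithinAt)
      ((h.cont x 0 self_mem_Ici).mono Ioi_subset_Ici_self) self_mem_nhdsWithin ?_
  have : Tendsto (fun s => U s y) (𝓝[>] 0) (𝓝 (U 0 y)) :=
    ((h.cont y 0 self_mem_Ici).mono Ioi_subset_Ici_self)
  rw [h.apply_zero] at this
  refine this.congr' ?_
  filter_upwards [self_mem_nhdsWithin] with s hs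
  exact (hpos s hs).deriv.symm

theorem tendsto_slope_iff (h : IsPropagator Γ E P ν U) (hΓ : Function.Injective Γ) {x y : X}
    (hx : P x = x) (hy : P y = y) :
    Tendsto (fun s : ℝ => s⁻¹ • (U s x - x)) (𝓝[>] 0) (𝓝 y) ↔ Γ y = E x := by
  have key : ∀ {Y : Type _} [NormedAddCommGroup Y] [NormedSpace ℝ Y] (f : ℝ → Y) (y : Y),
      HasDerivWithinAt f y (Ici 0) 0 ↔
        Tendsto (fun s : ℝ => s⁻¹ • (f s - f 0)) (𝓝[>] 0) (𝓝 y) := by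
    intro Y _ _ f y
    rw [hasDerivWithinAt_iff_tendsto_slope]
    simp [slope_fun_def]
  constructor
  · intro ht
    have h1 := (key _ _).1 (h.hasDerivWithinAt x le_rfl)
    have h2 := (Γ.continuous.tendsto y).comp ht
    rw [h.apply_zero, hx] at h1
    refine tendsto_nhds_unique (h2.congr fun s => ?_) h1
    change Γ (s⁻¹ • (U s x - x)) = _
    rw [← Complex.coe_smul, map_smul, map_sub, Complex.coe_smul]
  · intro hxy
    have h1 := (key _ _).1 (h.hasDerivWithinAt_of_eq hΓ hxy)
    rwa [h.apply_zero, hx, hy] at h1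

/-! ### Constructions with propagators -/

theorem neg_neg (h : IsPropagator Γ E P ν U) : IsPropagator (-Γ) (-E) P ν U where
  zero := h.zero
  add := h.add
  cont := h.cont
  bound := h.bound
  intertwines t ht x y hxy := by
    simpa using h.intertwines t ht x y (by simpa using hxy)
  deriv t ht x := by
    obtain ⟨d, hd, he⟩ := h.deriv t ht x
    exact ⟨d, hd, by simpa using he⟩

/-- The substitution `u = e^{-ηt} v` turns `Γ u' = E u` into `Γ v' = (E + ηΓ) v`. -/
theorem shift (h : IsPropagator Γ E P ν U) (η : ℝ) :
    IsPropagator Γ (E + (η : ℂ) • Γ) P (ν - η) (fun t => Real.exp (η * t) • U t) where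
  zero := by simp [h.zero]
  add s t hs ht := by
    ext x
    simp only [smul_apply, ContinuousLinearMap.comp_apply]
    rw [h.add_apply hs ht, mul_add, Real.exp_add, mul_smul, ContinuousLinearMap.map_smul_of_tower]
  cont x := by
    exact (Continuous.continuousOn (by fun_prop : Continuous fun t : ℝ => Real.exp (η * t))).smul
      (h.cont x)
  bound := by
    obtain ⟨M, hM⟩ := h.bound
    refine ⟨M, fun t ht => ?_⟩
    rw [norm_smul, Real.norm_eq_abs, Real.abs_exp]
    calc _ ≤ Real.exp (η * t) * (M * Real.exp (-ν * t)) := by gcongr; exact hM t ht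
      _ = M * (Real.exp (η * t) * Real.exp (-ν * t)) := by ring
      _ = _ := by rw [← Real.exp_add]; ring_nf
  intertwines t ht x y hxy := by
    have h1 : Γ (y - (η : ℂ) • x) = E x := by
      simp only [map_sub, map_smul, hxy]; simp
    have h2 := h.intertwines t ht x _ h1
    simp only [map_sub, map_smul, sub_eq_iff_eq_add] at h2
    simp only [smul_apply, ContinuousLinearMap.map_smul_of_tower, h2, _root_.add_apply,
      smul_add]
    rw [smul_comm]
  deriv t ht x := by
    obtain ⟨d, hd, he⟩ := h.deriv t ht x
    have hc : HasDerivAt (fun s : ℝ => Real.exp (η * s)) (Real.exp (η * t) * η) t := by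
      simpa using ((hasDerivAt_id t).const_mul η).exp
    refine ⟨_, hc.smul hd, ?_⟩
    simp only [smul_apply, ContinuousLinearMap.map_smul_of_tower, map_add, he, _root_.add_apply,
      mul_smul, Complex.coe_smul]
    rw [smul_comm]
    rfl

/-- Propagators on complementary ranges add up. -/
theorem add_of_comp_eq_zero (h : IsPropagator Γ E P ν U) (h' : IsPropagator Γ E P' ν U')
    (hPP' : P.comp P' = 0) (hP'P : P'.comp P = 0) :
    IsPropagator Γ E (P + P') ν (fun t => U t + U' t) where
  zero := by rw [h.zero, h'.zero]
  add s t hs ht := by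
    ext x
    have h1 : U s (U' t x) = 0 := by
      rw [← h'.proj_apply ht, ← h.apply_proj hs]
      simpa using congrArg (U s) (DFunLike.congr_fun hPP' (U' t x))
    have h2 : U' s (U t x) = 0 := by
      rw [← h.proj_apply ht, ← h'.apply_proj hs]
      simpa using congrArg (U' s) (DFunLike.congr_fun hP'P (U t x))
    simp [h.add_apply hs ht, h'.add_apply hs ht, h1, h2]
  cont x := (h.cont x).add (h'.cont x)
  bound := by
    obtain ⟨M, hM⟩ := h.bound
    obtain ⟨M', hM'⟩ := h'.bound
    exact ⟨M + M', fun t ht => (norm_add_le _ _).trans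
      ((add_le_add (hM t ht) (hM' t ht)).trans_eq (by ring))⟩
  intertwines t ht x y hxy := by
    simp [h.intertwines t ht x y hxy, h'.intertwines t ht x y hxy]
  deriv t ht x := by
    obtain ⟨d, hd, he⟩ := h.deriv t ht x
    obtain ⟨d', hd', he'⟩ := h'.deriv t ht x
    exact ⟨d + d', hd.add hd', by simp [he, he']⟩

theorem of_rate_le (h : IsPropagator Γ E P ν U) {μ : ℝ} (hμ : μ ≤ ν) : IsPropagator Γ E P μ U where
  zero := h.zero
  add := h.add
  cont := h.cont
  bound := by
    obtain ⟨M, hM0, hM⟩ := h.exists_bound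
    refine ⟨M, fun t ht => (hM t ht).trans ?_⟩
    gcongr
  intertwines := h.intertwines
  deriv := h.deriv

/-- The constant propagator on a space of equilibria. -/
theorem const (hP : P.comp P = P) (hEP : E.comp P = 0)
    (hcomm : ∀ x y, Γ y = E x → P y = 0) : IsPropagator Γ E P 0 (fun _ => P) where
  zero := rfl
  add _ _ _ _ := hP.symm
  cont _ := continuousOn_const
  bound := ⟨‖P‖, by simp⟩
  intertwines t _ x y hxy := by
    rw [hcomm x y hxy, map_zero]
    exact (DFunLike.congr_fun hEP x).symm
  deriv t _ x := ⟨0, hasDerivAt_const _ _, by rw [map_zero]; exact (DFunLike.congr_fun hEP x).symm⟩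

/-! ### Generation of bi-semigroups -/

/-- The semigroup on the range of the projection of a propagator. -/
def toC0Semigroup (h : IsPropagator Γ E P ν U) :
    C0Semigroup (LinearMap.range (P : X →ₗ[ℂ] X)) where
  op t := (U |t| ∘L (LinearMap.range (P : X →ₗ[ℂ] X)).subtypeL).codRestrict _
    fun x => ⟨U |t| x, h.proj_apply (abs_nonneg t) x⟩
  op_zero := by
    ext ⟨_, x, rfl⟩
    simp only [abs_zero, ContinuousLinearMap.coe_codRestrict_apply,
      ContinuousLinearMap.comp_apply, Submodule.subtypeL_apply, h.apply_zero,
      ContinuousLinearMap.id_apply]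
    exact DFunLike.congr_fun h.proj_comp x
  op_add s t hs ht := by
    ext x
    simp only [abs_of_nonneg, hs, ht, add_nonneg, ContinuousLinearMap.coe_codRestrict_apply,
      ContinuousLinearMap.comp_apply, Submodule.subtypeL_apply]
    exact h.add_apply hs ht x
  continuousOn_op x := by
    rw [Topology.IsInducing.subtypeVal.continuousOn_iff]
    refine (h.cont x).congr fun t ht => ?_
    simp [abs_of_nonneg (mem_Ici.1 ht)]

theorem toC0Semigroup_op (h : IsPropagator Γ E P ν U) {t : ℝ} (ht : 0 ≤ t)
    (x : LinearMap.range (P : X →ₗ[ℂ] X)) : (h.toC0Semigroup.op t x : X) = U t x := by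
  simp [toC0Semigroup, abs_of_nonneg ht]

theorem expStable (h : IsPropagator Γ E P ν U) (hν : 0 < ν) : h.toC0Semigroup.ExpStable := by
  obtain ⟨M, hM0, hM⟩ := h.exists_bound
  refine ⟨M, ν, hν, fun t ht => ContinuousLinearMap.opNorm_le_bound _ (by positivity) fun x => ?_⟩
  change ‖(h.toC0Semigroup.op t x : X)‖ ≤ _
  rw [h.toC0Semigroup_op ht]
  exact (U t).le_of_opNorm_le (hM t ht) x

theorem isGenerator (h : IsPropagator Γ E P ν U) (hΓ : Function.Injective Γ)
    {G : LinearMap.range (P : X →ₗ[ℂ] X) →ₗ.[ℂ] LinearMap.range (P : X →ₗ[ℂ] X)}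
    (hG : ∀ x y, (x, y) ∈ G.graph ↔ Γ (y : X) = E (x : X)) : h.toC0Semigroup.IsGenerator G := by
  have hfix : ∀ x : LinearMap.range (P : X →ₗ[ℂ] X), P x = x := by
    rintro ⟨_, x, rfl⟩
    exact DFunLike.congr_fun h.proj_comp x
  intro x y
  rw [hG, ← h.tendsto_slope_iff hΓ (hfix x) (hfix y), tendsto_subtype_rng]
  refine tendsto_congr' ?_
  filter_upwards [self_mem_nhdsWithin] with s hs
  rw [← h.toC0Semigroup_op (mem_Ioi.1 hs).le x]
  rfl

end IsPropagator

theorem mem_graph_invMulOp {Γ E : X →L[ℂ] X} (hΓ : Function.Injective Γ) (x y : X) :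
    (x, y) ∈ (invMulOp Γ E).graph ↔ Γ y = E x := by
  rw [invMulOp, Submodule.toLinearPMap_graph_eq]
  · simp [sub_eq_zero]
  · rintro ⟨x, y⟩ hxy rfl
    apply hΓ
    simpa [sub_eq_zero] using hxy

theorem mem_graph_partIn (S : X →ₗ.[ℂ] X) (Y : Submodule ℂ X) (x y : Y) :
    (x, y) ∈ (partIn S Y).graph ↔ ((x : X), (y : X)) ∈ S.graph := by
  rw [partIn, Submodule.toLinearPMap_graph_eq]
  · simp
  · rintro ⟨x, y⟩ hxy rfl
    exact Subtype.ext (S.graph_fst_eq_zero_snd (by simpa using hxy) rfl)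

theorem mem_graph_neg (S : X →ₗ.[ℂ] X) (x y : X) : (x, y) ∈ (-S).graph ↔ (x, -y) ∈ S.graph := by
  rw [LinearPMap.neg_graph]
  constructor
  · rintro ⟨⟨a, b⟩, hab, he⟩
    simp only [LinearMap.prodMap_apply, LinearMap.id_apply, LinearMap.neg_apply,
      Prod.mk.injEq] at he
    simpa [← he.1, ← he.2] using hab
  · intro h
    exact ⟨_, h, by simp⟩

/-- Propagators of `Γ u' = E u` forward and backward in time, on complementary ranges, make up a
bi-semigroup generated by `Γ⁻¹ E`. -/
theorem exists_biSemigroup {Γ E P P' : X →L[ℂ] X} {ν : ℝ} {U U' : ℝ → X →L[ℂ] X}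
    (hΓ : Function.Injective Γ) (hν : 0 < ν) (h : IsPropagator Γ E P ν U)
    (h' : IsPropagator Γ (-E) P' ν U') (hPP' : P + P' = ContinuousLinearMap.id ℂ X) :
    ∃ b : BiSemigroup X, b.IsGeneratedBy (invMulOp Γ E) ∧ b.ExpStable := by
  have hsum : ∀ x, P x + P' x = x := fun x => DFunLike.congr_fun hPP' x
  have hP : ∀ x, P (P x) = P x := DFunLike.congr_fun h.proj_comp
  have hP' : ∀ x, P' (P' x) = P' x := DFunLike.congr_fun h'.proj_comp
  have h0 : ∀ x, P' (P x) = 0 := fun x => by simpa [hP] using hsum (P x)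
  have hr : ∀ x, x ∈ LinearMap.range (P : X →ₗ[ℂ] X) ↔ P x = x :=
    fun x => ⟨by rintro ⟨x, rfl⟩; exact hP x, fun h => ⟨x, h⟩⟩
  have hr' : ∀ x, x ∈ LinearMap.range (P' : X →ₗ[ℂ] X) ↔ P' x = x :=
    fun x => ⟨by rintro ⟨x, rfl⟩; exact hP' x, fun h => ⟨x, h⟩⟩
  have hint : ∀ {x y}, Γ y = E x → Γ (P' y) = E (P' x) := fun {x y} hxy => by
    have := h'.proj_intertwines (x := x) (y := -y) (by simpa using hxy)
    simpa using this
  have hgr : ∀ x : (invMulOp Γ E).domain, Γ (invMulOp Γ E x) = E x := fun x =>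
    (mem_graph_invMulOp hΓ _ _).1 (LinearPMap.mem_graph _ x)
  let b : BiSemigroup X :=
    { fst := LinearMap.range (P : X →ₗ[ℂ] X)
      snd := LinearMap.range (P' : X →ₗ[ℂ] X)
      isClosed_fst := by
        convert isClosed_eq P.continuous continuous_id using 1
        ext x; exact hr x
      isClosed_snd := by
        convert isClosed_eq P'.continuous continuous_id using 1
        ext x; exact hr' x
      isCompl := by
        refine ⟨Submodule.disjoint_def.2 fun x hx hx' => ?_,
          codisjoint_iff.2 (eq_top_iff.2 fun x _ => ?_)⟩
        · rw [hr] at hx; rw [hr'] at hx'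
          rw [← hx', ← hx, h0]
        · rw [← hsum x]
          exact Submodule.add_mem_sup ⟨x, rfl⟩ ⟨x, rfl⟩
      semigroupFst := h.toC0Semigroup
      semigroupSnd := h'.toC0Semigroup }
  refine ⟨b, ⟨fun x hx => ?_, fun x hx => ?_, fun x hx => ?_, ?_, ?_⟩,
    h.expStable hν, h'.expStable hν⟩
  · have hx1 := (hr _).1 hx
    refine (hr _).2 (hΓ ?_)
    rw [h.proj_intertwines (hgr x), hx1, hgr]
  · have hx1 := (hr' _).1 hx
    refine (hr' _).2 (hΓ ?_)
    rw [hint (hgr x), hx1, hgr]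
  · obtain ⟨y, hy⟩ := LinearPMap.mem_domain_iff.1 hx
    rw [mem_graph_invMulOp hΓ] at hy
    rw [← hsum x]
    refine Submodule.add_mem_sup ⟨?_, x, rfl⟩ ⟨?_, x, rfl⟩
    · exact LinearPMap.mem_domain_iff.2
        ⟨P y, (mem_graph_invMulOp hΓ _ _).2 (h.proj_intertwines hy)⟩
    · exact LinearPMap.mem_domain_iff.2 ⟨P' y, (mem_graph_invMulOp hΓ _ _).2 (hint hy)⟩
  · exact h.isGenerator hΓ fun x y => by rw [mem_graph_partIn, mem_graph_invMulOp hΓ]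
  · refine h'.isGenerator hΓ fun x y => ?_
    rw [mem_graph_neg, mem_graph_partIn, mem_graph_invMulOp hΓ]
    simp [neg_eq_iff_eq_neg]

/-! ### Solutions from propagators -/

theorem MildUnique.eqOn {Γ E : X →L[ℂ] X} (hu : MildUnique Γ E) {J : Set ℝ} (hJ : Convex ℝ J)
    (h0 : (0 : ℝ) ∈ J) {u w : ℝ → X} (hw : IsMildSolutionOn Γ E J w)
    (hum : IsMildSolutionOn Γ E J u) (h : w 0 = u 0) : EqOn w u J := fun t ht => by
  refine sub_eq_zero.1 (hu J hJ h0 (w - u) ⟨hw.1.sub hum.1, fun s hs => ?_⟩ (by simp [h]) t ht)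
  simpa [Pi.sub_def] using (hw.2 s hs).sub (hum.2 s hs)

theorem MildUnique.shift {Γ E : X →L[ℂ] X} (hu : MildUnique Γ E) (η : ℝ) :
    MildUnique Γ (E + (η : ℂ) • Γ) := fun J hJ h0 w hw hw0 t ht => by
  have key := hu J hJ h0 (fun s => Real.exp (-η * s) • w s)
    ⟨(Continuous.continuousOn
      (by fun_prop : Continuous fun t : ℝ => Real.exp (-η * t))).smul hw.1, fun s hs => ?_⟩
    (by simp [hw0]) t ht
  · simpa using key
  · have hc : HasDerivAt (fun s : ℝ => Real.exp (-η * s)) (Real.exp (-η * s) * -η) s := by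
      simpa using ((hasDerivAt_id s).const_mul (-η)).exp
    have := hc.hasDerivWithinAt.smul (hw.2 s hs)
    change HasDerivWithinAt (fun s => Γ (Real.exp (-η * s) • w s)) (E (Real.exp (-η * s) • w s)) J s
    have hsmul : ∀ (T : X →L[ℂ] X) (c : ℝ) (x : X), T (c • x) = c • T x :=
      fun T c x => T.map_smul_of_tower c x
    simp only [hsmul]
    refine this.congr_deriv ?_
    simp only [_root_.add_apply, smul_apply, smul_add, mul_smul, neg_smul, smul_neg,
      Complex.coe_smul]
    abel

variable {Γ E P P' : X →L[ℂ] X} {ν : ℝ} {U U' : ℝ → X →L[ℂ] X}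

theorem IsPropagator.isTheSolutionOn_Ici (h : IsPropagator Γ E P ν U) (hu : MildUnique Γ E) {x : X}
    (hx : P x = x) : IsTheSolutionOn Γ E (Ici 0) x (fun t => U t x) where
  isSolution := ⟨h.cont x, fun t ht => h.deriv t (by simpa using ht) x⟩
  initial := by rw [h.apply_zero, hx]
  unique w hw hw0 := hu.eqOn (convex_Ici 0) self_mem_Ici hw
    ⟨h.cont x, fun t ht => h.hasDerivWithinAt x ht⟩ (by rw [hw0, h.apply_zero, hx])

theorem IsPropagator.isTheSolutionOn_Iic (h : IsPropagator Γ (-E) P ν U) (hu : MildUnique Γ E)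
    {x : X} (hx : P x = x) : IsTheSolutionOn Γ E (Iic 0) x (fun t => U (-t) x) := by
  have hmaps : MapsTo (fun t : ℝ => -t) (Iic 0) (Ici 0) := fun t ht => by simpa using ht
  have hcont : ContinuousOn (fun t => U (-t) x) (Iic 0) :=
    (h.cont x).comp continuousOn_neg hmaps
  refine ⟨⟨hcont, fun t ht => ?_⟩, by rw [neg_zero, h.apply_zero, hx], fun w hw hw0 => ?_⟩
  · obtain ⟨d, hd, he⟩ := h.deriv (-t) (by simpa using ht) x
    refine ⟨-d, ?_, by simp [he]⟩
    simpa [Function.comp_def] using hd.scomp t (hasDerivAt_neg t)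
  · refine hu.eqOn (convex_Iic 0) self_mem_Iic hw ⟨hcont, fun t ht => ?_⟩
      (by rw [hw0, neg_zero, h.apply_zero, hx])
    have h1 := h.hasDerivWithinAt x (t := -t) (hmaps ht)
    simpa [Function.comp_def] using h1.scomp t (hasDerivAt_neg t).hasDerivWithinAt hmaps

theorem hasExponentialDichotomy_of_isPropagator (hu : MildUnique Γ E) (hν : 0 < ν)
    (h : IsPropagator Γ E P ν U) (h' : IsPropagator Γ (-E) P' ν U')
    (hPP' : P + P' = ContinuousLinearMap.id ℂ X) : HasExponentialDichotomy Γ E := by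
  have hsum : ∀ x, P x + P' x = x := fun x => DFunLike.congr_fun hPP' x
  obtain ⟨M, hM0, hM⟩ := h.exists_bound
  obtain ⟨M', hM0', hM'⟩ := h'.exists_bound
  refine ⟨P, max M M', ν, h.proj_comp, hν,
    fun x hx => ⟨_, h.isTheSolutionOn_Ici hu hx, fun t ht => ⟨h.proj_apply ht x, ?_⟩⟩,
    fun x hx => ⟨_, h'.isTheSolutionOn_Iic hu (by simpa [hx] using hsum x),
      fun t ht => ⟨?_, ?_⟩⟩⟩
  · refine (U t).le_of_opNorm_le ((hM t ht).trans ?_) x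
    gcongr
    exact le_max_left _ _
  · simpa [h'.proj_apply (neg_nonneg.2 ht)] using hsum (U' (-t) x)
  · refine (U' (-t)).le_of_opNorm_le ((hM' (-t) (neg_nonneg.2 ht)).trans ?_) x
    rw [neg_mul_neg]
    gcongr
    exact le_max_right _ _

theorem isInternal_range_of_projections {ι : Type*} [Fintype ι] [DecidableEq ι]
    (P : ι → X →L[ℂ] X) (hidem : ∀ i x, P i (P i x) = P i x)
    (horth : ∀ i j, i ≠ j → ∀ x, P i (P j x) = 0) (hsum : ∀ x, ∑ i, P i x = x) :
    DirectSum.IsInternal fun i => LinearMap.range (P i : X →ₗ[ℂ] X) := by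
  rw [DirectSum.isInternal_submodule_iff_iSupIndep_and_iSup_eq_top]
  refine ⟨fun i => ?_, eq_top_iff.2 fun x _ => ?_⟩
  · have hle : ⨆ j, ⨆ (_ : j ≠ i), LinearMap.range (P j : X →ₗ[ℂ] X) ≤
        LinearMap.ker (P i : X →ₗ[ℂ] X) := by
      refine iSup₂_le fun j hj => ?_
      rintro _ ⟨x, rfl⟩
      exact horth i j hj.symm x
    refine Disjoint.mono_right hle (Submodule.disjoint_def.2 ?_)
    rintro _ ⟨x, rfl⟩ hx
    have : P i (P i x) = 0 := hx
    rwa [hidem] at this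
  · rw [← hsum x]
    exact Submodule.sum_mem _ fun i _ =>
      Submodule.mem_iSup_of_mem (p := fun i => LinearMap.range (P i : X →ₗ[ℂ] X)) i ⟨x, rfl⟩

/-- A splitting of the state space of `Γ u' = E u` into equilibria (`Pc`), data of solutions that
decay with rate `ν` forward in time (`P`, `U`), and data of solutions that decay with rate `ν`
backward in time (`P'`, `U'`). -/
structure IsTrichotomy (Γ E Pc P P' : X →L[ℂ] X) (ν : ℝ) (U U' : ℝ → X →L[ℂ] X) : Prop where
  stable : IsPropagator Γ E P ν U
  unstable : IsPropagator Γ (-E) P' ν U'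
  sum : Pc + P + P' = ContinuousLinearMap.id ℂ X
  center_comp : Pc.comp Pc = Pc
  stable_comp_unstable : P.comp P' = 0
  unstable_comp_stable : P'.comp P = 0
  comp_center : E.comp Pc = 0
  center_eq_zero : ∀ x y, Γ y = E x → Pc y = 0

namespace IsTrichotomy

variable {Pc : X →L[ℂ] X}

theorem symm (h : IsTrichotomy Γ E Pc P P' ν U U') : IsTrichotomy Γ (-E) Pc P' P ν U' U where
  stable := h.unstable
  unstable := by simpa using h.stable
  sum := by rw [← h.sum]; abel
  center_comp := h.center_comp
  stable_comp_unstable := h.unstable_comp_stable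
  unstable_comp_stable := h.stable_comp_unstable
  comp_center := by simp [h.comp_center]
  center_eq_zero x y hxy := by
    have := h.center_eq_zero x (-y) (by simp [hxy])
    simpa using this

theorem sum_apply (h : IsTrichotomy Γ E Pc P P' ν U U') (x : X) : Pc x + P x + P' x = x :=
  DFunLike.congr_fun h.sum x

theorem center_stable (h : IsTrichotomy Γ E Pc P P' ν U U') (x : X) : Pc (P x) = 0 := by
  have h1 : P (P x) = P x := DFunLike.congr_fun h.stable.proj_comp x
  have h2 : P' (P x) = 0 := DFunLike.congr_fun h.unstable_comp_stable x
  simpa [h1, h2] using h.sum_apply (P x)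

theorem stable_center (h : IsTrichotomy Γ E Pc P P' ν U U') (x : X) : P (Pc x) = 0 := by
  have h1 : Pc (Pc x) = Pc x := DFunLike.congr_fun h.center_comp x
  have h2 : P (Pc x) + P' (Pc x) = 0 := by simpa [h1, add_assoc] using h.sum_apply (Pc x)
  have h3 : P (P (Pc x)) = P (Pc x) := DFunLike.congr_fun h.stable.proj_comp _
  have h4 : P (P' (Pc x)) = 0 := DFunLike.congr_fun h.stable_comp_unstable _
  simpa [h3, h4] using congrArg P h2

/-- Adding `ηΓ` with a small `η > 0` turns the equilibria into backward decaying data. -/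
theorem exists_shift (h : IsTrichotomy Γ E Pc P P' ν U U') {η : ℝ} (hη : 0 < η) (hην : η < ν) :
    ∃ (Q : X →L[ℂ] X) (μ : ℝ) (W W' : ℝ → X →L[ℂ] X), 0 < μ ∧
      P + Q = ContinuousLinearMap.id ℂ X ∧ IsPropagator Γ (E + (η : ℂ) • Γ) P μ W ∧
      IsPropagator Γ (-(E + (η : ℂ) • Γ)) Q μ W' := by
  have hE : -(E + (η : ℂ) • Γ) = -E + ((-η : ℝ) : ℂ) • Γ := by
    rw [neg_add, Complex.ofReal_neg, neg_smul]
  have hcenter : IsPropagator Γ (-E) Pc 0 (fun _ => Pc) :=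
    IsPropagator.const h.center_comp h.symm.comp_center h.symm.center_eq_zero
  rw [hE]
  refine ⟨P' + Pc, min (ν - η) η, _, _, lt_min (sub_pos.2 hην) hη, by rw [← h.sum]; abel,
    (h.stable.shift η).of_rate_le (min_le_left _ _),
    ((h.unstable.shift (-η)).of_rate_le ?_).add_of_comp_eq_zero
      ((hcenter.shift (-η)).of_rate_le ?_) ?_ ?_⟩
  · exact (min_le_left _ _).trans (by linarith)
  · exact (min_le_right _ _).trans (by linarith)
  · ext x; exact h.symm.stable_center x
  · ext x; exact h.symm.center_stable x

/-- For a small shift `ηΓ` of the pencil with `η > 0`, the shifted equation has a bi-semigroup and an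
exponential dichotomy, with the equilibria on the unstable side. -/
theorem shift_add (h : IsTrichotomy Γ E Pc P P' ν U U') (hΓ : Function.Injective Γ)
    (hu : MildUnique Γ E) {η : ℝ} (hη : 0 < η) (hην : η < ν) :
    (∃ b : BiSemigroup X, b.IsGeneratedBy (invMulOp Γ (E + (η : ℂ) • Γ)) ∧ b.ExpStable) ∧
      HasExponentialDichotomy Γ (E + (η : ℂ) • Γ) := by
  obtain ⟨Q, μ, W, W', hμ, hsum, h1, h2⟩ := h.exists_shift hη hην
  exact ⟨exists_biSemigroup hΓ hμ h1 h2 hsum,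
    hasExponentialDichotomy_of_isPropagator (hu.shift η) hμ h1 h2 hsum⟩

/-- The same with the shift `-ηΓ`, and with the equilibria on the stable side. -/
theorem shift_sub (h : IsTrichotomy Γ E Pc P P' ν U U') (hΓ : Function.Injective Γ)
    (hu : MildUnique Γ E) {η : ℝ} (hη : 0 < η) (hην : η < ν) :
    (∃ b : BiSemigroup X, b.IsGeneratedBy (invMulOp Γ (E - (η : ℂ) • Γ)) ∧ b.ExpStable) ∧
      HasExponentialDichotomy Γ (E - (η : ℂ) • Γ) := by
  obtain ⟨Q, μ, W, W', hμ, hsum, h1, h2⟩ := h.symm.exists_shift hη hην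
  have hu' := hu.shift (-η)
  have e1 : -E + (η : ℂ) • Γ = -(E - (η : ℂ) • Γ) := by abel
  have e2 : E + ((-η : ℝ) : ℂ) • Γ = E - (η : ℂ) • Γ := by
    rw [Complex.ofReal_neg, neg_smul, sub_eq_add_neg]
  rw [e1] at h1
  rw [e1, neg_neg] at h2
  rw [e2] at hu'
  rw [add_comm] at hsum
  exact ⟨exists_biSemigroup hΓ hμ h2 h1 hsum,
    hasExponentialDichotomy_of_isPropagator hu' hμ h2 h1 hsum⟩

theorem hasCenterStableUnstableDecomposition (h : IsTrichotomy Γ E Pc P P' ν U U')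
    (hu : MildUnique Γ E) (hν : 0 < ν) :
    HasCenterStableUnstableDecomposition Γ E (LinearMap.range (Pc : X →ₗ[ℂ] X)) := by
  have hP : ∀ x, P (P x) = P x := DFunLike.congr_fun h.stable.proj_comp
  have hP' : ∀ x, P' (P' x) = P' x := DFunLike.congr_fun h.unstable.proj_comp
  have hc : ∀ x, Pc (Pc x) = Pc x := DFunLike.congr_fun h.center_comp
  have h1 : ∀ x, P (P' x) = 0 := DFunLike.congr_fun h.stable_comp_unstable
  have h2 : ∀ x, P' (P x) = 0 := DFunLike.congr_fun h.unstable_comp_stable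
  have hr : ∀ x, x ∈ LinearMap.range (P : X →ₗ[ℂ] X) ↔ P x = x :=
    fun x => ⟨by rintro ⟨x, rfl⟩; exact hP x, fun h => ⟨x, h⟩⟩
  have hr' : ∀ x, x ∈ LinearMap.range (P' : X →ₗ[ℂ] X) ↔ P' x = x :=
    fun x => ⟨by rintro ⟨x, rfl⟩; exact hP' x, fun h => ⟨x, h⟩⟩
  obtain ⟨M, hM0, hM⟩ := h.stable.exists_bound
  obtain ⟨M', hM0', hM'⟩ := h.unstable.exists_bound
  refine ⟨LinearMap.range (P : X →ₗ[ℂ] X), LinearMap.range (P' : X →ₗ[ℂ] X), ?_, ?_, ?_, ?_,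
    max M M', ν, hν,
    fun x hx => ⟨_, h.stable.isTheSolutionOn_Ici hu ((hr x).1 hx), fun t ht => ?_⟩,
    fun x hx => ⟨_, h.unstable.isTheSolutionOn_Iic hu ((hr' x).1 hx), fun t ht => ?_⟩⟩
  · convert isClosed_eq P.continuous continuous_id using 1
    ext x; exact hr x
  · convert isClosed_eq P'.continuous continuous_id using 1
    ext x; exact hr' x
  · have := isInternal_range_of_projections ![Pc, P, P'] (by
      intro i x; fin_cases i <;> simp [hP, hP', hc]) (by
      intro i j hij x
      fin_cases i <;> fin_cases j <;>
        simp_all [h.center_stable, h.stable_center, h.symm.center_stable, h.symm.stable_center]) (by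
      intro x; simpa [Fin.sum_univ_three] using h.sum_apply x)
    convert this using 1
    ext i x
    fin_cases i <;> simp
  · rintro _ ⟨x, rfl⟩
    have hE : E (Pc x) = 0 := DFunLike.congr_fun h.comp_center x
    have hd : ∀ t : ℝ, HasDerivAt (fun _ : ℝ => Γ (Pc x)) (E (Pc x)) t := fun t => by
      rw [hE]; exact hasDerivAt_const _ _
    exact ⟨⟨continuousOn_const, fun t _ => ⟨0, hasDerivAt_const _ _, by simp [hE]⟩⟩, rfl,
      fun w hw hw0 => hu.eqOn convex_univ (mem_univ _) hw
        ⟨continuousOn_const, fun t _ => (hd t).hasDerivWithinAt⟩ hw0⟩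
  · refine (U t).le_of_opNorm_le ((hM t ht).trans ?_) x
    gcongr
    exact le_max_left _ _
  · refine (U' (-t)).le_of_opNorm_le ((hM' (-t) (neg_nonneg.2 ht)).trans ?_) x
    rw [neg_mul_neg]
    gcongr
    exact le_max_right _ _

end IsTrichotomy

end Propagator

/-! ### Reduction of one pencil to another -/

section Reduction

variable {X Y : Type*} [NormedAddCommGroup X] [NormedSpace ℂ X]
  [NormedAddCommGroup Y] [NormedSpace ℂ Y]

/-- The pencil `(Γ, E)` on `X` reduces to the pencil `(Γ', E')` on `Y`: solutions of `Γ' y' = E' y`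
are carried by the embedding `ι` to solutions of `Γ u' = E u`, solutions of the latter are carried by
the left inverse `π` of `ι` to solutions of the former, and `E` only sees the part `ι π u` of `u`. -/
structure PencilReduction (Γ E : X →L[ℂ] X) (Γ' E' : Y →L[ℂ] Y) where
  /-- the embedding of the reduced state space -/
  ι : Y →L[ℂ] X
  /-- the projection onto the reduced state space -/
  π : X →L[ℂ] Y
  /-- the embedding on the side of the values of the pencils -/
  j : Y →L[ℂ] X
  /-- the elimination of the redundant equations -/
  q : X →L[ℂ] Y
  π_ι : ∀ y, π (ι y) = y
  Γ_ι : ∀ y, Γ (ι y) = j (Γ' y)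
  E_ι : ∀ y, E (ι y) = j (E' y)
  q_Γ : ∀ x, q (Γ x) = Γ' (π x)
  q_E : ∀ x, q (E x) = E' (π x)
  E_ι_π : ∀ x, E (ι (π x)) = E x

variable {Γ E : X →L[ℂ] X} {Γ' E' : Y →L[ℂ] Y}

namespace PencilReduction

/-- Reversal of time in a reduction. -/
def negRight (r : PencilReduction Γ E Γ' E') : PencilReduction Γ (-E) Γ' (-E') where
  ι := r.ι
  π := r.π
  j := r.j
  q := r.q
  π_ι := r.π_ι
  Γ_ι := r.Γ_ι
  E_ι y := by simp [r.E_ι]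
  q_Γ := r.q_Γ
  q_E x := by simp [r.q_E]
  E_ι_π x := by simp [r.E_ι_π]

theorem mildUnique (r : PencilReduction Γ E Γ' E') (hΓ : Function.Injective Γ)
    (hu : MildUnique Γ' E') : MildUnique Γ E := fun J hJ h0 w hw hw0 t ht => by
  have hπ : ∀ s ∈ J, r.π (w s) = 0 := by
    refine hu J hJ h0 (fun s => r.π (w s))
      ⟨r.π.continuous.comp_continuousOn hw.1, fun s hs => ?_⟩ (by simp [hw0])
    have := (r.q.restrictScalars ℝ).hasFDerivAt.comp_hasDerivWithinAt s (hw.2 s hs)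
    simpa [Function.comp_def, r.q_Γ, r.q_E] using this
  -- the redundant part of `w` does not contribute to `E w`, so `Γ w` is constant
  have hE : ∀ s ∈ J, E (w s) = 0 := fun s hs => by rw [← r.E_ι_π, hπ s hs, map_zero, map_zero]
  have := eq_of_hasDerivWithinAt_zero hJ h0 (f := fun s => Γ (w s))
    (fun s hs => by simpa [hE s hs] using hw.2 s hs) ht
  apply hΓ
  simpa [hw0] using this

theorem isPropagator (r : PencilReduction Γ E Γ' E') {P : Y →L[ℂ] Y}
    {ν : ℝ} {U : ℝ → Y →L[ℂ] Y} (h : IsPropagator Γ' E' P ν U) :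
    IsPropagator Γ E ((r.ι.comp P).comp r.π) ν (fun t => (r.ι.comp (U t)).comp r.π) where
  zero := by rw [h.zero]
  add s t hs ht := by ext x; simp [h.add_apply hs ht, r.π_ι]
  cont x := r.ι.continuous.comp_continuousOn (h.cont (r.π x))
  bound := by
    obtain ⟨M, hM⟩ := h.bound
    refine ⟨‖r.ι‖ * M * ‖r.π‖, fun t ht => ?_⟩
    calc _ ≤ ‖r.ι‖ * ‖U t‖ * ‖r.π‖ := (ContinuousLinearMap.opNorm_comp_le _ _).trans <| by
            gcongr; exact ContinuousLinearMap.opNorm_comp_le _ _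
      _ ≤ ‖r.ι‖ * (M * Real.exp (-ν * t)) * ‖r.π‖ := by gcongr; exact hM t ht
      _ = _ := by ring
  intertwines t ht x y hxy := by
    have := h.intertwines t ht (r.π x) (r.π y) (by rw [← r.q_Γ, hxy, r.q_E])
    simp [r.Γ_ι, r.E_ι, this]
  deriv t ht x := by
    obtain ⟨d, hd, he⟩ := h.deriv t ht (r.π x)
    refine ⟨r.ι d, (r.ι.restrictScalars ℝ).hasFDerivAt.comp_hasDerivAt t hd, ?_⟩
    simp [r.Γ_ι, r.E_ι, he]

/-- A dichotomy of the reduced equation gives a trichotomy of the full one, whose equilibria are the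
kernel of the projection `π`. -/
theorem isTrichotomy (r : PencilReduction Γ E Γ' E') (hΓ : Function.Injective Γ)
    {P P' : Y →L[ℂ] Y} {ν : ℝ} {U U' : ℝ → Y →L[ℂ] Y} (h : IsPropagator Γ' E' P ν U)
    (h' : IsPropagator Γ' (-E') P' ν U') (hPP' : P + P' = ContinuousLinearMap.id ℂ Y) :
    IsTrichotomy Γ E (ContinuousLinearMap.id ℂ X - r.ι.comp r.π) ((r.ι.comp P).comp r.π)
      ((r.ι.comp P').comp r.π) ν (fun t => (r.ι.comp (U t)).comp r.π)
      (fun t => (r.ι.comp (U' t)).comp r.π) := by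
  have hsum : ∀ y, P y + P' y = y := fun y => DFunLike.congr_fun hPP' y
  have h1 : ∀ y, P (P' y) = 0 := fun y => by
    simpa [show P' (P' y) = P' y from DFunLike.congr_fun h'.proj_comp y] using hsum (P' y)
  have h2 : ∀ y, P' (P y) = 0 := fun y => by
    simpa [show P (P y) = P y from DFunLike.congr_fun h.proj_comp y] using hsum (P y)
  refine ⟨r.isPropagator h, r.negRight.isPropagator h', ?_, ?_, ?_, ?_, ?_, fun x y hxy => ?_⟩
  · ext x
    simp [add_assoc, ← map_add, hsum]
  · ext x
    simp [r.π_ι]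
  · ext x
    simp [r.π_ι, h1]
  · ext x
    simp [r.π_ι, h2]
  · ext x
    simp [r.E_ι_π]
  · have : Γ (r.ι (r.π y)) = Γ y := by
      rw [r.Γ_ι, ← r.q_Γ, hxy, r.q_E, ← r.E_ι, r.E_ι_π]
    simp [hΓ this]

end PencilReduction

end Reduction

/-! ### The decay function and its kernel -/

section DecayFun

/-- The function `x ↦ e^{-t/x}` for `x > 0`, continued by `0` to `x ≤ 0`. -/
def decayFun (t x : ℝ) : ℝ := if 0 < x then Real.exp (-t / x) else 0

theorem decayFun_of_pos (t : ℝ) {x : ℝ} (hx : 0 < x) : decayFun t x = Real.exp (-t / x) :=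
  if_pos hx

theorem decayFun_of_nonpos (t : ℝ) {x : ℝ} (hx : x ≤ 0) : decayFun t x = 0 :=
  if_neg hx.not_gt

theorem decayFun_add (s t x : ℝ) : decayFun (s + t) x = decayFun s x * decayFun t x := by
  rcases lt_or_ge 0 x with hx | hx
  · rw [decayFun_of_pos _ hx, decayFun_of_pos _ hx, decayFun_of_pos _ hx, ← Real.exp_add]
    ring_nf
  · simp [decayFun_of_nonpos _ hx]

theorem mul_decayFun_div (t x : ℝ) : x * (decayFun t x / x) = decayFun t x := by
  rcases eq_or_ne x 0 with rfl | hx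
  · simp [decayFun_of_nonpos]
  · field_simp

theorem posPart_mul_decayFun_div (t x : ℝ) : max x 0 * (decayFun t x / x) = decayFun t x := by
  rcases lt_or_ge 0 x with hx | hx
  · rw [max_eq_left hx.le, mul_decayFun_div]
  · simp [decayFun_of_nonpos _ hx]

/-- The decay of the exponential dominates two powers of `1 / x`. -/
theorem exp_neg_le_two_div_sq {s : ℝ} (hs : 0 < s) : Real.exp (-s) ≤ 2 / s ^ 2 := by
  have h := Real.quadratic_le_exp_of_nonneg hs.le
  rw [Real.exp_neg, ← one_div, div_le_div_iff₀ (Real.exp_pos s) (by positivity)]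
  nlinarith

theorem continuous_decayFun_div {t : ℝ} (ht : 0 < t) : Continuous fun x => decayFun t x / x := by
  rw [continuous_iff_continuousAt]
  intro x
  rcases lt_trichotomy x 0 with hx | rfl | hx
  · refine ContinuousAt.congr (f := fun _ => (0 : ℝ)) continuousAt_const ?_
    filter_upwards [Iio_mem_nhds hx] with y hy
    simp [decayFun_of_nonpos t (le_of_lt hy)]
  · have hb : ∀ x : ℝ, ‖decayFun t x / x‖ ≤ 2 / t ^ 2 * |x| := fun x => by
      rcases lt_or_ge 0 x with hx | hx
      · rw [decayFun_of_pos t hx, Real.norm_of_nonneg (by positivity), abs_of_pos hx, neg_div,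
          div_le_iff₀ hx]
        refine (exp_neg_le_two_div_sq (by positivity)).trans_eq ?_
        field_simp
      · rw [decayFun_of_nonpos t hx]
        simp only [zero_div, norm_zero]
        positivity
    have h0 : Tendsto (fun x : ℝ => 2 / t ^ 2 * |x|) (𝓝 0) (𝓝 0) := by
      have : Continuous fun x : ℝ => 2 / t ^ 2 * |x| := by fun_prop
      simpa using this.tendsto 0
    have : decayFun t 0 / 0 = 0 := by simp
    rw [ContinuousAt, this]
    exact squeeze_zero_norm hb h0
  · refine ContinuousAt.congr (f := fun y => Real.exp (-t / y) / y) ?_ ?_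
    · fun_prop (disch := exact hx.ne')
    · filter_upwards [Ioi_mem_nhds hx] with y hy
      rw [decayFun_of_pos t hy]

theorem continuous_decayFun {t : ℝ} (ht : 0 < t) : Continuous (decayFun t) := by
  have : decayFun t = fun x => x * (decayFun t x / x) := funext fun x => (mul_decayFun_div t x).symm
  rw [this]
  exact continuous_id.mul (continuous_decayFun_div ht)

theorem decayFun_nonneg (t x : ℝ) : 0 ≤ decayFun t x := by
  unfold decayFun; split_ifs <;> positivity

theorem decayFun_le {t x c : ℝ} (ht : 0 ≤ t) (hx : x ≤ c) :
    decayFun t x ≤ Real.exp (-(1 / c) * t) := by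
  rcases lt_or_ge 0 x with h | h
  · rw [decayFun_of_pos t h, Real.exp_le_exp, neg_div, neg_mul, neg_le_neg_iff, one_div_mul_eq_div]
    gcongr
  · rw [decayFun_of_nonpos t h]
    positivity

/-- As `t → 0`, the decay function tends to the indicator of `x > 0`, uniformly with the weight `x`. -/
theorem abs_decayFun_mul_posPart_sub_le {t : ℝ} (ht : 0 ≤ t) (x : ℝ) :
    |decayFun t x * max x 0 - max x 0| ≤ t := by
  rcases lt_or_ge 0 x with h | h
  · rw [decayFun_of_pos t h, max_eq_left h.le, abs_le]
    have h1 : 1 - t / x ≤ Real.exp (-t / x) := by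
      rw [neg_div]; exact Real.one_sub_le_exp_neg _
    have h2 : Real.exp (-t / x) ≤ 1 := by
      rw [Real.exp_le_one_iff, neg_div]
      exact neg_nonpos.2 (by positivity)
    have h3 : (1 - t / x) * x = x - t := by field_simp
    constructor <;> nlinarith [mul_le_mul_of_nonneg_right h1 h.le]
  · simpa [max_eq_right h] using ht

theorem abs_exp_sub_one_sub_id_le (z : ℝ) : |Real.exp z - 1 - z| ≤ z ^ 2 * Real.exp |z| := by
  have h := Complex.norm_exp_sub_sum_le_norm_mul_exp (z : ℂ) 2
  simp only [Finset.sum_range_succ, Finset.sum_range_zero, zero_add, pow_zero, pow_one,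
    Nat.factorial_zero, Nat.factorial_one, Nat.cast_one, div_one] at h
  rw [← sub_sub, Complex.norm_real, Real.norm_eq_abs, sq_abs] at h
  rwa [← Complex.ofReal_exp, ← Complex.ofReal_one, ← Complex.ofReal_sub, ← Complex.ofReal_sub,
    Complex.norm_real, Real.norm_eq_abs] at h

/-- The decay function is differentiable with respect to time, uniformly in `x`. -/
theorem abs_decayFun_sub_le {t h : ℝ} (ht : 0 < t) (hh : |h| ≤ t / 2) (x : ℝ) :
    |decayFun (t + h) x - decayFun t x + h * (decayFun t x / x)| ≤ 8 / t ^ 2 * h ^ 2 := by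
  rcases lt_or_ge 0 x with hx | hx
  · rw [decayFun_add, decayFun_of_pos t hx, decayFun_of_pos h hx]
    have h1 := abs_exp_sub_one_sub_id_le (-h / x)
    have h2 : Real.exp (-t / x) * Real.exp |(-h / x)| ≤ 8 / t ^ 2 * x ^ 2 := by
      rw [← Real.exp_add]
      calc _ ≤ Real.exp (-(t / 2 / x)) := by
            rw [Real.exp_le_exp, abs_div, abs_neg, abs_of_pos hx, ← add_div, ← neg_div]
            gcongr
            linarith
        _ ≤ _ := exp_neg_le_two_div_sq (by positivity)
        _ = _ := by field_simp; norm_num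
    calc _ = Real.exp (-t / x) * |Real.exp (-h / x) - 1 - -h / x| := by
          rw [← abs_of_pos (Real.exp_pos (-t / x)), ← abs_mul, abs_of_pos (Real.exp_pos (-t / x))]
          congr 1; ring
      _ ≤ Real.exp (-t / x) * ((-h / x) ^ 2 * Real.exp |(-h / x)|) := by gcongr
      _ = (-h / x) ^ 2 * (Real.exp (-t / x) * Real.exp |(-h / x)|) := by ring
      _ ≤ (-h / x) ^ 2 * (8 / t ^ 2 * x ^ 2) := by gcongr
      _ = _ := by field_simp
  · simp only [decayFun_of_nonpos _ hx]
    simp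
    positivity

end DecayFun

/-! ### The equation `G y' = -y` with a self-adjoint one-to-one `G` -/

section SelfAdjoint

/-- A product rule for operators that are linear over `ℂ`, along real times. -/
theorem hasDerivWithinAt_clm_apply {X : Type*} [NormedAddCommGroup X] [NormedSpace ℂ X]
    {c : ℝ → X →L[ℂ] X} {c' : X →L[ℂ] X} {u : ℝ → X} {u' : X}
    {J : Set ℝ} {t : ℝ} (hc : HasDerivWithinAt c c' J t) (hu : HasDerivWithinAt u u' J t) :
    HasDerivWithinAt (fun s => c s (u s)) (c' (u t) + c t u') J t :=
  ((ContinuousLinearMap.restrictScalarsL ℂ X X ℝ ℝ).hasFDerivAt.comp_hasDerivWithinAt t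
    hc).clm_apply hu

variable {X : Type*} [NormedAddCommGroup X] [InnerProductSpace ℂ X] [CompleteSpace X]
  {G : X →L[ℂ] X}

theorem norm_cfc_le_of_abs_le {f : ℝ → ℝ} {c : ℝ} (hc : 0 ≤ c)
    (h : ∀ x, |x| ≤ ‖G‖ → |f x| ≤ c) : ‖cfc f G‖ ≤ c := by
  refine norm_cfc_le hc fun x hx => h x ?_
  refine (spectrum.norm_le_norm_mul_of_mem hx).trans ?_
  exact mul_le_of_le_one_right (norm_nonneg _) ContinuousLinearMap.norm_id_le

theorem cfc_mul_apply {f g : ℝ → ℝ} (hf : Continuous f) (hg : Continuous g) (x : X) :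
    cfc (fun s => f s * g s) G x = cfc f G (cfc g G x) := by
  rw [cfc_mul f g G hf.continuousOn hg.continuousOn]; rfl

/-- The positive part of `G`. -/
def posOp (G : X →L[ℂ] X) : X →L[ℂ] X := cfc (fun x : ℝ => max x 0) G

theorem isSelfAdjoint_posOp : IsSelfAdjoint (posOp G) := cfc_predicate _ _

/-- The orthogonal projection onto the closure of the range of the positive part of `G`. -/
def posProj (G : X →L[ℂ] X) : X →L[ℂ] X :=
  (LinearMap.range (posOp G : X →ₗ[ℂ] X)).topologicalClosure.starProjection

theorem posProj_posPart (x : X) :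
    posProj G (posOp G x) = posOp G x :=
  Submodule.starProjection_eq_self_iff.2 (Submodule.le_topologicalClosure _ ⟨x, rfl⟩)

theorem posProj_eq_zero {x : X} (hx : posOp G x = 0) : posProj G x = 0 := by
  rw [posProj, Submodule.starProjection_apply_eq_zero_iff, Submodule.orthogonal_closure,
    Submodule.mem_orthogonal]
  rintro _ ⟨y, rfl⟩
  have hsa : IsSelfAdjoint (posOp G) := isSelfAdjoint_posOp
  have := (ContinuousLinearMap.isSelfAdjoint_iff_isSymmetric.1 hsa) y x
  simp only [ContinuousLinearMap.coe_coe] at this ⊢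
  rw [this, hx, inner_zero_right]

theorem posPart_posProj (x : X) :
    posOp G (posProj G x) = posOp G x := by
  rw [eq_comm, ← sub_eq_zero, ← map_sub]
  have h := Submodule.sub_starProjection_mem_orthogonal (K :=
    (LinearMap.range (posOp G : X →ₗ[ℂ] X)).topologicalClosure) x
  rw [Submodule.orthogonal_closure, Submodule.mem_orthogonal] at h
  have hsa : IsSelfAdjoint (posOp G) := isSelfAdjoint_posOp
  rw [← inner_self_eq_zero (𝕜 := ℂ)]
  have := (ContinuousLinearMap.isSelfAdjoint_iff_isSymmetric.1 hsa)
    (posOp G (x - posProj G x)) (x - posProj G x)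
  simp only [ContinuousLinearMap.coe_coe] at this
  rw [← this]
  exact h _ ⟨_, rfl⟩

theorem norm_posProj_le : ‖posProj G‖ ≤ 1 := Submodule.starProjection_norm_le _

theorem denseRange_of_isSelfAdjoint (hG : IsSelfAdjoint G) (hinj : Function.Injective G) :
    DenseRange G := by
  have h := ContinuousLinearMap.orthogonal_ker G
  rw [hG.adjoint_eq, LinearMap.ker_eq_bot.2 (by exact hinj), Submodule.bot_orthogonal_eq_top] at h
  have := (Submodule.dense_iff_topologicalClosure_eq_top).2 h.symm
  exact this

/-- Since `G` is one-to-one, the spectral subspaces of `x > 0` and `x < 0` exhaust the space. -/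
theorem posProj_add_posProj_neg (hG : IsSelfAdjoint G) (hinj : Function.Injective G) :
    posProj G + posProj (-G) = ContinuousLinearMap.id ℂ X := by
  have hm : Continuous fun x : ℝ => max x 0 := by fun_prop
  have hm' : Continuous fun x : ℝ => max (-x) 0 := by fun_prop
  have hpos : posOp G = cfc (fun x : ℝ => max x 0) G := rfl
  have hneg : posOp (-G) = cfc (fun x : ℝ => max (-x) 0) G :=
    (cfc_comp_neg (fun x : ℝ => max x 0) G).symm
  have hsub : ∀ x, G x = posOp G x - posOp (-G) x := by
    intro x
    rw [hneg, hpos, ← _root_.sub_apply, ← cfc_sub _ _ G hm.continuousOn hm'.continuousOn]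
    conv_lhs => rw [← cfc_id ℝ G]
    congr 2
    ext s
    rcases le_total 0 s with h | h <;> simp [h]
  have hz : ∀ x, posOp G (posOp (-G) x) = 0 := by
    intro x
    rw [hneg, hpos, ← cfc_mul_apply hm hm']
    have : (fun s : ℝ => max s 0 * max (-s) 0) = fun _ => 0 := by
      ext s
      rcases le_total 0 s with h | h <;> simp [h]
    simp [this]
  have hz' : ∀ x, posOp (-G) (posOp G x) = 0 := by
    intro x
    rw [hneg, hpos, ← cfc_mul_apply hm' hm]
    have : (fun s : ℝ => max (-s) 0 * max s 0) = fun _ => 0 := by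
      ext s
      rcases le_total 0 s with h | h <;> simp [h]
    simp [this]
  refine ContinuousLinearMap.ext fun x => congrFun
    ((denseRange_of_isSelfAdjoint hG hinj).equalizer (ContinuousLinearMap.continuous _)
      (ContinuousLinearMap.continuous _) (funext fun y => ?_)) x
  simp only [Function.comp_apply, _root_.add_apply, ContinuousLinearMap.id_apply]
  rw [hsub y]
  simp only [map_sub, posProj_posPart, posProj_eq_zero (hz _), posProj_eq_zero (hz' _)]
  abel

/-- The semigroup `e^{-t/x}` of the part of `G` in `x > 0`. At `t = 0`, where the decay function is
not continuous, the projection takes the place of the functional calculus. -/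
def posSemigroup (G : X →L[ℂ] X) (t : ℝ) : X →L[ℂ] X :=
  if 0 < t then cfc (decayFun t) G else posProj G

theorem posSemigroup_zero : posSemigroup G 0 = posProj G := if_neg (lt_irrefl _)

theorem posSemigroup_of_pos {t : ℝ} (ht : 0 < t) : posSemigroup G t = cfc (decayFun t) G :=
  if_pos ht

theorem posSemigroup_posProj {t : ℝ} (ht : 0 < t) (x : X) :
    posSemigroup G t (posProj G x) = posSemigroup G t x := by
  have hm : Continuous fun x : ℝ => max x 0 := by fun_prop
  have h : ∀ y, posSemigroup G t y =
      cfc (fun x => decayFun t x / x) G (posOp G y) := fun y => by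
    rw [posSemigroup_of_pos ht, posOp, ← cfc_mul_apply (continuous_decayFun_div ht) hm]
    simp_rw [mul_comm _ (max _ _), posPart_mul_decayFun_div]
  rw [h, h, posPart_posProj]

theorem posProj_posSemigroup {t : ℝ} (ht : 0 < t) (x : X) :
    posProj G (posSemigroup G t x) = posSemigroup G t x := by
  have hm : Continuous fun x : ℝ => max x 0 := by fun_prop
  have h : posSemigroup G t x =
      posOp G (cfc (fun x => decayFun t x / x) G x) := by
    rw [posSemigroup_of_pos ht, posOp, ← cfc_mul_apply hm (continuous_decayFun_div ht)]
    simp_rw [posPart_mul_decayFun_div]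
  rw [h, posProj_posPart]

theorem posProj_posProj (x : X) : posProj G (posProj G x) = posProj G x :=
  Submodule.starProjection_eq_self_iff.2 (Submodule.starProjection_apply_mem _ _)

theorem norm_posSemigroup_le {t : ℝ} (ht : 0 ≤ t) :
    ‖posSemigroup G t‖ ≤ Real.exp (-(1 / (‖G‖ + 1)) * t) := by
  rcases ht.eq_or_lt with rfl | ht
  · simpa [posSemigroup_zero] using norm_posProj_le
  · rw [posSemigroup_of_pos ht]
    refine norm_cfc_le_of_abs_le (Real.exp_pos _).le fun x hx => ?_
    rw [abs_of_nonneg (decayFun_nonneg t x)]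
    exact decayFun_le ht.le (by linarith [le_abs_self x])

theorem hasDerivAt_posSemigroup {t : ℝ} (ht : 0 < t) :
    HasDerivAt (posSemigroup G) (-cfc (fun x => decayFun t x / x) G) t := by
  rw [hasDerivAt_iff_isLittleO_nhds_zero]
  have hO : (fun h => posSemigroup G (t + h) - posSemigroup G t -
      h • -cfc (fun x => decayFun t x / x) G) =O[𝓝 0] fun h : ℝ => h ^ 2 := by
    refine Asymptotics.IsBigO.of_bound (8 / t ^ 2) ?_
    filter_upwards [Metric.ball_mem_nhds (0 : ℝ) (half_pos ht)] with h hh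
    rw [Metric.mem_ball, dist_zero_right, Real.norm_eq_abs] at hh
    have hth : 0 < t + h := by linarith [neg_abs_le h]
    have hc := continuous_decayFun_div ht
    have e : posSemigroup G (t + h) - posSemigroup G t - h • -cfc (fun x => decayFun t x / x) G =
        cfc (fun x => decayFun (t + h) x - decayFun t x + h * (decayFun t x / x)) G := by
      rw [cfc_add (a := G) (fun x => decayFun (t + h) x - decayFun t x)
          (fun x => h * (decayFun t x / x))
          ((continuous_decayFun hth).sub (continuous_decayFun ht)).continuousOn
          (continuous_const.mul hc).continuousOn,
        cfc_sub (a := G) _ _ (continuous_decayFun hth).continuousOn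
          (continuous_decayFun ht).continuousOn,
        cfc_const_mul (a := G) h _ hc.continuousOn, posSemigroup_of_pos ht,
        posSemigroup_of_pos hth]
      simp
    rw [e, Real.norm_of_nonneg (sq_nonneg h)]
    exact norm_cfc_le_of_abs_le (by positivity) fun x _ => abs_decayFun_sub_le ht hh.le x
  exact hO.trans_isLittleO (by simpa using Asymptotics.isLittleO_pow_id one_lt_two)

theorem continuousOn_posSemigroup (x : X) :
    ContinuousOn (fun t => posSemigroup G t x) (Ici 0) := by
  intro t ht
  rcases (mem_Ici.1 ht).eq_or_lt with rfl | ht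
  · rw [Metric.continuousWithinAt_iff]
    intro ε hε
    have hmem : posProj G x ∈ closure (range (posOp G)) :=
      Submodule.starProjection_apply_mem
        (LinearMap.range (posOp G : X →ₗ[ℂ] X)).topologicalClosure x
    obtain ⟨_, ⟨y, rfl⟩, hy⟩ := Metric.mem_closure_iff.1 hmem (ε / 4) (by positivity)
    refine ⟨ε / (2 * (‖y‖ + 1)), by positivity, fun {t} ht htd => ?_⟩
    rw [posSemigroup_zero]
    rcases (mem_Ici.1 ht).eq_or_lt with rfl | ht
    · simpa [posSemigroup_zero] using hε
    rw [dist_zero_right, Real.norm_of_nonneg ht.le, lt_div_iff₀ (by positivity)] at htd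
    rw [dist_eq_norm] at hy ⊢
    set p := posOp G y with hp
    have h1 : ‖posSemigroup G t (posProj G x - p)‖ ≤ ‖posProj G x - p‖ := by
      refine ((posSemigroup G t).le_of_opNorm_le (norm_posSemigroup_le ht.le) _).trans ?_
      refine mul_le_of_le_one_left (norm_nonneg _) (Real.exp_le_one_iff.2 ?_)
      rw [neg_mul]
      exact neg_nonpos.2 (by positivity)
    have h2 : ‖posSemigroup G t p - p‖ ≤ t * ‖y‖ := by
      have hm : Continuous fun x : ℝ => max x 0 := by fun_prop
      have hc := continuous_decayFun ht
      have e : posSemigroup G t p - p =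
          cfc (fun x : ℝ => decayFun t x * max x 0 - max x 0) G y := by
        rw [cfc_sub (a := G) (fun x : ℝ => decayFun t x * max x 0) (fun x => max x 0)
          (hc.mul hm).continuousOn hm.continuousOn, _root_.sub_apply, cfc_mul_apply hc hm,
          posSemigroup_of_pos ht]
        rfl
      rw [e]
      exact ContinuousLinearMap.le_of_opNorm_le _
        (norm_cfc_le_of_abs_le ht.le fun x _ => abs_decayFun_mul_posPart_sub_le ht.le x) y
    have e : posSemigroup G t x - posProj G x = posSemigroup G t (posProj G x - p) +
        (posSemigroup G t p - p) - (posProj G x - p) := by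
      rw [map_sub, posSemigroup_posProj ht]; abel
    rw [e]
    refine (norm_sub_le _ _).trans_lt (((add_le_add_left (norm_add_le _ _) _)).trans_lt ?_)
    nlinarith [norm_nonneg y]
  · exact (hasDerivWithinAt_clm_apply (hasDerivAt_posSemigroup (G := G) ht).hasDerivWithinAt
      (hasDerivWithinAt_const t _ x)).continuousWithinAt

theorem posSemigroup_commute {t : ℝ} (ht : 0 ≤ t) (x : X) :
    posSemigroup G t (G x) = G (posSemigroup G t x) := by
  have hpos : ∀ t, 0 < t → posSemigroup G t (G x) = G (posSemigroup G t x) := fun t ht => by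
    rw [posSemigroup_of_pos ht]
    have h := (Commute.refl G).cfc_real (decayFun t)
    exact DFunLike.congr_fun h.eq x
  rcases ht.eq_or_lt with rfl | ht
  · have h1 : Tendsto (fun t => posSemigroup G t (G x)) (𝓝[>] 0) (𝓝 (posSemigroup G 0 (G x))) :=
      (continuousOn_posSemigroup (G x) 0 self_mem_Ici).mono Ioi_subset_Ici_self
    have h2 : Tendsto (fun t => G (posSemigroup G t x)) (𝓝[>] 0) (𝓝 (G (posSemigroup G 0 x))) :=
      (G.continuous.tendsto _).comp
        ((continuousOn_posSemigroup x 0 self_mem_Ici).mono Ioi_subset_Ici_self)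
    refine tendsto_nhds_unique h1 (h2.congr' ?_)
    filter_upwards [self_mem_nhdsWithin] with t ht
    exact (hpos t ht).symm
  · exact hpos t ht

theorem isPropagator_posSemigroup (hG : IsSelfAdjoint G) :
    IsPropagator G (-ContinuousLinearMap.id ℂ X) (posProj G) (1 / (‖G‖ + 1)) (posSemigroup G) where
  zero := posSemigroup_zero
  add s t hs ht := by
    ext x
    simp only [ContinuousLinearMap.comp_apply]
    rcases hs.eq_or_lt with rfl | hs
    · rw [zero_add, posSemigroup_zero]
      rcases ht.eq_or_lt with rfl | ht
      · rw [posSemigroup_zero, posProj_posProj]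
      · rw [posProj_posSemigroup ht]
    · rcases ht.eq_or_lt with rfl | ht
      · rw [add_zero, posSemigroup_zero, posSemigroup_posProj hs]
      · rw [posSemigroup_of_pos hs, posSemigroup_of_pos ht, posSemigroup_of_pos (add_pos hs ht),
          ← cfc_mul_apply (continuous_decayFun hs) (continuous_decayFun ht)]
        simp_rw [← decayFun_add]
  cont := continuousOn_posSemigroup
  bound := ⟨1, fun t ht => by simpa using norm_posSemigroup_le ht⟩
  intertwines t ht x y hxy := by
    rw [← posSemigroup_commute ht, hxy]
    simp
  deriv t ht x := by
    refine ⟨-cfc (fun x => decayFun t x / x) G x, ?_, ?_⟩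
    · rw [← hasDerivWithinAt_univ]
      simpa using hasDerivWithinAt_clm_apply (hasDerivAt_posSemigroup (G := G) ht).hasDerivWithinAt
        (hasDerivWithinAt_const t univ x)
    · have h := cfc_mul_apply (G := G) continuous_id (continuous_decayFun_div ht) x
      simp only [id_eq, mul_decayFun_div] at h
      rw [cfc_id ℝ G] at h
      simp [posSemigroup_of_pos ht, h]

/-! ### Uniqueness of mild solutions -/

/-- After a spectral cut-off near `0` the equation `G y' = -y` becomes an ordinary differential
equation `y' = -m(G) y` with a bounded coefficient. No growth condition is needed. -/
theorem mildUnique_of_isSelfAdjoint (hG : IsSelfAdjoint G) (hinj : Function.Injective G) :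
    MildUnique G (-ContinuousLinearMap.id ℂ X) := by
  intro J hJ h0 w hw hw0 t ht
  apply hinj
  rw [map_zero, ← norm_eq_zero]
  refine le_antisymm (le_of_forall_pos_le_add fun ε' hε' => ?_) (norm_nonneg _)
  set ε := ε' / (‖w t‖ + 1) with hε
  have hεpos : 0 < ε := by positivity
  -- `h` cuts off the interval `[-ε, ε]`, and `m x = 1 / x` outside of it
  set h : ℝ → ℝ := fun x => x - max (-ε) (min x ε) with hh
  set m : ℝ → ℝ := fun x => x / max (x ^ 2) (ε ^ 2) with hm
  have hhc : Continuous h := by fun_prop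
  have hmc : Continuous m := by
    refine continuous_id.div (by fun_prop) fun x => ?_
    positivity
  have hhm : ∀ x, h x * m x * x = h x := by
    intro x
    rcases le_or_gt (|x|) ε with hx | hx
    · rw [abs_le] at hx
      have : h x = 0 := by simp [hh, hx.1, hx.2]
      simp [this]
    · have hsq : ε ^ 2 ≤ x ^ 2 := by
        rw [← sq_abs x]; gcongr
      have hx0 : x ≠ 0 := by
        rintro rfl
        simp at hx
        linarith
      simp only [hm, max_eq_left hsq]
      field_simp
  have hhx : ∀ x, |h x - x| ≤ ε := by
    intro x
    rw [abs_le]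
    simp only [hh]
    constructor
    · linarith [max_le (show -ε ≤ ε by linarith) (min_le_right x ε)]
    · linarith [le_max_left (-ε) (min x ε)]
  have hGid : ∀ x, cfc (fun s : ℝ => s) G x = G x := fun x => by rw [cfc_id' ℝ G]
  have hhmG : ∀ x, cfc (fun s => h s * m s) G (G x) = cfc h G x := fun x => by
    rw [← hGid, ← cfc_mul_apply (f := fun s => h s * m s) (hhc.mul hmc) continuous_id']
    simp_rw [hhm]
  have hmh : ∀ x, cfc (fun s => h s * m s) G x = cfc m G (cfc h G x) := fun x => by
    rw [← cfc_mul_apply hmc hhc]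
    simp_rw [mul_comm]
  have hq : ∀ s ∈ J, HasDerivWithinAt (fun s => cfc h G (w s)) (-cfc m G (cfc h G (w s))) J s := by
    intro s hs
    have h1 := ((cfc (fun s => h s * m s) G).restrictScalars ℝ).hasFDerivAt.comp_hasDerivWithinAt s
      (hw.2 s hs)
    simpa [Function.comp_def, hhmG, hmh] using h1
  have hr : ∀ s ∈ J, HasDerivWithinAt
      (fun s => NormedSpace.exp (s • cfc m G) (cfc h G (w s))) 0 J s := by
    intro s hs
    have h1 := hasDerivAt_exp_smul_const (𝕂 := ℝ) (cfc m G) s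
    have h2 := hasDerivWithinAt_clm_apply (h1.hasDerivWithinAt (s := J)) (hq s hs)
    simpa using h2
  have hconst := eq_of_hasDerivWithinAt_zero hJ h0 hr ht
  simp only [hw0, map_zero] at hconst
  have hq0 : cfc h G (w t) = 0 := by
    have h1 := congrArg (NormedSpace.exp (-(t • cfc m G)) : X →L[ℂ] X) hconst
    let _ : NormedAlgebra ℚ (X →L[ℂ] X) := .restrictScalars ℚ ℂ _
    rw [map_zero, ← mul_apply_eq_comp, ← NormedSpace.exp_add_of_commute
      (Commute.neg_left (Commute.refl _))] at h1
    simpa using h1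
  have hlast : ‖cfc h G (w t) - G (w t)‖ ≤ ε * ‖w t‖ := by
    rw [← hGid, ← _root_.sub_apply, ← cfc_sub _ _ G hhc.continuousOn continuous_id'.continuousOn]
    exact ContinuousLinearMap.le_of_opNorm_le _
      (norm_cfc_le_of_abs_le hεpos.le fun x _ => hhx x) _
  rw [hq0, zero_sub, norm_neg] at hlast
  refine hlast.trans ?_
  rw [hε, zero_add, div_mul_eq_mul_div, div_le_iff₀ (by positivity)]
  nlinarith [norm_nonneg (w t)]

end SelfAdjoint

/-! ### Pencils of self-adjoint operators with a definite right-hand side -/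

section Definite

variable {X : Type*} [NormedAddCommGroup X] [InnerProductSpace ℂ X] [CompleteSpace X]

/-- A uniformly negative self-adjoint operator is `-D²` with `D` self-adjoint and invertible. -/
theorem exists_sqrt_of_negative {E : X →L[ℂ] X} (hE : IsSelfAdjoint E) {δ : ℝ} (hδ : 0 < δ)
    (hneg : ∀ x, (inner ℂ (E x) x).re ≤ -δ * ‖x‖ ^ 2) :
    ∃ D C : X →L[ℂ] X, IsSelfAdjoint C ∧ D * C = 1 ∧ C * D = 1 ∧ E = -(D * D) := by
  have hle : algebraMap ℝ (X →L[ℂ] X) δ ≤ -E := by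
    have hsa : IsSelfAdjoint (algebraMap ℝ (X →L[ℂ] X) δ) := .algebraMap _ (.all δ)
    rw [ContinuousLinearMap.le_def, ContinuousLinearMap.isPositive_def]
    refine ⟨ContinuousLinearMap.isSelfAdjoint_iff_isSymmetric.1 (hE.neg.sub hsa), fun x => ?_⟩
    have h1 : (inner ℂ (algebraMap ℝ (X →L[ℂ] X) δ x) x).re = δ * ‖x‖ ^ 2 := by
      rw [show algebraMap ℝ (X →L[ℂ] X) δ x = (δ : ℂ) • x by
        rw [Algebra.algebraMap_eq_smul_one, smul_apply, Complex.coe_smul]; rfl]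
      rw [inner_smul_left, inner_self_eq_norm_sq_to_K]
      simp [← Complex.ofReal_pow]
    have h2 := hneg x
    rw [ContinuousLinearMap.reApplyInnerSelf_apply, _root_.sub_apply, _root_.neg_apply,
      inner_sub_left, inner_neg_left, map_sub, map_neg, RCLike.re_to_complex,
      RCLike.re_to_complex, h1]
    linarith
  have hpos : IsStrictlyPositive (algebraMap ℝ (X →L[ℂ] X) δ) :=
    isStrictlyPositive_algebraMap hδ
  have hunit : IsUnit (-E) := CStarAlgebra.isUnit_of_le _ hle
  have hnonneg : 0 ≤ -E := hpos.nonneg.trans hle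
  obtain ⟨u, hu⟩ := (CFC.isUnit_sqrt_iff (-E)).2 hunit
  have hD : IsSelfAdjoint (CFC.sqrt (-E)) := (CFC.sqrt_nonneg _).isSelfAdjoint
  refine ⟨u, ↑u⁻¹, ?_, u.mul_inv, u.inv_mul, ?_⟩
  · rw [← hu] at hD
    have h1 : star (↑u⁻¹ : X →L[ℂ] X) * (u : X →L[ℂ] X) = 1 := by
      calc _ = star ((u : X →L[ℂ] X) * ↑u⁻¹) := by rw [star_mul, hD.star_eq]
        _ = 1 := by rw [u.mul_inv, star_one]
    exact left_inv_eq_right_inv h1 u.mul_inv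
  · rw [hu, CFC.sqrt_mul_sqrt_self (-E)]
    simp

/-- If `Γ` is self-adjoint and `E = -D²`, then `y = D u` turns `Γ u' = E u` into `G y' = -y`, with the
self-adjoint operator `G = D⁻¹ Γ D⁻¹`. -/
theorem exists_reduction_of_negative {Γ E : X →L[ℂ] X} (hΓ : IsSelfAdjoint Γ)
    (hinj : Function.Injective Γ) (hE : IsSelfAdjoint E) {δ : ℝ} (hδ : 0 < δ)
    (hneg : ∀ x, (inner ℂ (E x) x).re ≤ -δ * ‖x‖ ^ 2) :
    ∃ G : X →L[ℂ] X, IsSelfAdjoint G ∧ Function.Injective G ∧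
      Nonempty (PencilReduction Γ E G (-ContinuousLinearMap.id ℂ X)) := by
  obtain ⟨D, C, hC, hDC, hCD, rfl⟩ := exists_sqrt_of_negative hE hδ hneg
  have hDC' : ∀ x, D (C x) = x := DFunLike.congr_fun hDC
  have hCD' : ∀ x, C (D x) = x := DFunLike.congr_fun hCD
  have hCinj : Function.Injective C := Function.LeftInverse.injective hDC'
  refine ⟨C * Γ * C, ?_, hCinj.comp (hinj.comp hCinj), ⟨⟨C, D, D, C, hDC', ?_, ?_, ?_, ?_, ?_⟩⟩⟩
  · simpa [hC.star_eq] using hΓ.conjugate C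
  all_goals intro x; simp [hDC', hCD']

/-- The pencil of a self-adjoint one-to-one `Γ` and a uniformly negative `E` has a dichotomy. -/
theorem exists_dichotomy_of_negative {Γ E : X →L[ℂ] X} (hΓ : IsSelfAdjoint Γ)
    (hinj : Function.Injective Γ) (hE : IsSelfAdjoint E) {δ : ℝ} (hδ : 0 < δ)
    (hneg : ∀ x, (inner ℂ (E x) x).re ≤ -δ * ‖x‖ ^ 2) :
    MildUnique Γ E ∧ ∃ (P P' : X →L[ℂ] X) (ν : ℝ) (U U' : ℝ → X →L[ℂ] X), 0 < ν ∧
      P + P' = ContinuousLinearMap.id ℂ X ∧ IsPropagator Γ E P ν U ∧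
      IsPropagator Γ (-E) P' ν U' := by
  obtain ⟨G, hG, hGinj, ⟨r⟩⟩ := exists_reduction_of_negative hΓ hinj hE hδ hneg
  have h1 := isPropagator_posSemigroup hG
  have h2 := (isPropagator_posSemigroup hG.neg).neg_neg
  rw [neg_neg, norm_neg] at h2
  refine ⟨r.mildUnique hinj (mildUnique_of_isSelfAdjoint hG hGinj), _, _, _, _, _, by positivity, ?_,
    r.isPropagator h1, r.negRight.isPropagator h2⟩
  ext x
  have hsum : posProj G (r.π x) + posProj (-G) (r.π x) = r.π x :=
    DFunLike.congr_fun (posProj_add_posProj_neg hG hGinj) _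
  have hιπ : r.ι (r.π x) - x = 0 := by
    have := hneg (r.ι (r.π x) - x)
    rw [map_sub, r.E_ι_π, sub_self, inner_zero_left, Complex.zero_re] at this
    rw [← norm_eq_zero, ← sq_eq_zero_iff]
    nlinarith [sq_nonneg ‖r.ι (r.π x) - x‖]
  change r.ι (posProj G (r.π x)) + r.ι (posProj (-G) (r.π x)) = x
  rw [← map_add, hsum, sub_eq_zero.1 hιπ]

end Definite

/-! ### Elimination of the equilibria -/

section Blocks

variable {H : Type*} [NormedAddCommGroup H] [InnerProductSpace ℂ H]
  {V : Submodule ℂ H} [CompleteSpace V] {A T : H →L[ℂ] H}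

theorem coe_opBlock_apply (Y Z : Submodule ℂ H) [Z.HasOrthogonalProjection] (T : H →L[ℂ] H) (y : Y) :
    opBlock Y Z T y = Z.orthogonalProjectionOnto (T y) := rfl

theorem coe_proj_add_coe_proj_orthogonal (x : H) :
    (V.orthogonalProjectionOnto x : H) + (Vᗮ.orthogonalProjectionOnto x : H) = x :=
  V.starProjection_add_starProjection_orthogonal x

/-- The component in `Vᗮ` of the solution `u` of `A u ∈ V` with a given component in `V`. -/
def slaveOp (V : Submodule ℂ H) [CompleteSpace V] (A : H →L[ℂ] H) : V →L[ℂ] Vᗮ :=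
  -(Ring.inverse (opBlock Vᗮ Vᗮ A)).comp (opBlock V Vᗮ A)

/-- The graph of `slaveOp`, as an embedding of `V` into the whole space. -/
def slaveGraph (V : Submodule ℂ H) [CompleteSpace V] (A : H →L[ℂ] H) : V →L[ℂ] H :=
  V.subtypeL + Vᗮ.subtypeL.comp (slaveOp V A)

theorem slaveGraph_apply (v : V) : slaveGraph V A v = (v : H) + (slaveOp V A v : H) := rfl

theorem proj_slaveGraph (v : V) : V.orthogonalProjectionOnto (slaveGraph V A v) = v := by
  rw [slaveGraph_apply, map_add, Submodule.orthogonalProjectionOnto_mem_subspace_eq_self]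
  rw [Submodule.orthogonalProjectionOnto_apply_of_mem_orthogonal (slaveOp V A v).2, add_zero]

theorem apply_slaveGraph (hA11 : IsUnit (opBlock Vᗮ Vᗮ A)) (v : V) :
    A (slaveGraph V A v) = reducedOp V A v := by
  rw [← coe_proj_add_coe_proj_orthogonal (V := V) (A (slaveGraph V A v))]
  have h1 : Vᗮ.orthogonalProjectionOnto (A (slaveGraph V A v)) = 0 := by
    have := DFunLike.congr_fun (Ring.mul_inverse_cancel _ hA11) (opBlock V Vᗮ A v)
    rw [slaveGraph_apply, map_add, map_add, ← coe_opBlock_apply, ← coe_opBlock_apply, slaveOp]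
    simp only [_root_.neg_apply, map_neg, ContinuousLinearMap.comp_apply]
    rw [← sub_eq_add_neg, sub_eq_zero]
    exact this.symm
  have h2 : V.orthogonalProjectionOnto (A (slaveGraph V A v)) = reducedOp V A v := by
    rw [slaveGraph_apply, map_add, map_add, ← coe_opBlock_apply, ← coe_opBlock_apply, slaveOp]
    simp [reducedOp, sub_eq_add_neg]
  rw [h1, h2]
  simp

theorem injective_reducedOp (hA11 : IsUnit (opBlock Vᗮ Vᗮ A)) (hinj : Function.Injective A) :
    Function.Injective (reducedOp V A) := by
  intro v w hvw
  have : slaveGraph V A v = slaveGraph V A w := hinj (by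
    rw [apply_slaveGraph hA11, apply_slaveGraph hA11, hvw])
  rw [← proj_slaveGraph (A := A) v, this, proj_slaveGraph]

variable [CompleteSpace H]

theorem isSelfAdjoint_reducedOp (hA : IsSelfAdjoint A) (hA11 : IsUnit (opBlock Vᗮ Vᗮ A)) :
    IsSelfAdjoint (reducedOp V A) := by
  rw [ContinuousLinearMap.isSelfAdjoint_iff_isSymmetric]
  -- both sides are values of the form of `A` on the range of `slaveGraph`
  have key : ∀ v w : V, inner ℂ (reducedOp V A v) w =
      inner ℂ (A (slaveGraph V A v)) (slaveGraph V A w) := fun v w => by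
    rw [apply_slaveGraph hA11, slaveGraph_apply, inner_add_right,
      Submodule.inner_right_of_mem_orthogonal (reducedOp V A v).2 (slaveOp V A w).2, add_zero]
    rfl
  intro v w
  simp only [ContinuousLinearMap.coe_coe]
  rw [key, ← inner_conj_symm v, key, inner_conj_symm]
  exact (ContinuousLinearMap.isSelfAdjoint_iff_isSymmetric.1 hA) _ _

namespace KawashimaCondition

theorem apply_mem (hT : KawashimaCondition V A T) (x : H) : T x ∈ V := by
  rw [← V.orthogonal_orthogonal, Submodule.mem_orthogonal]
  intro u hu
  rw [← hT.ker_eq] at hu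
  have := (ContinuousLinearMap.isSelfAdjoint_iff_isSymmetric.1 hT.isSelfAdjoint) u x
  simp only [ContinuousLinearMap.coe_coe] at this
  rw [← this, show T u = 0 from hu, inner_zero_left]

theorem coe_opBlock (hT : KawashimaCondition V A T) (v : V) : (opBlock V V T v : H) = T v := by
  rw [coe_opBlock_apply, Submodule.coe_orthogonalProjectionOnto_apply,
    Submodule.starProjection_eq_self_iff]
  exact hT.apply_mem _

theorem apply_of_mem_orthogonal {V : Submodule ℂ H} (hT : KawashimaCondition V A T) {x : H}
    (hx : x ∈ Vᗮ) : T x = 0 := by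
  rw [← hT.ker_eq] at hx
  exact hx

theorem apply_proj (hT : KawashimaCondition V A T) (x : H) :
    T (V.orthogonalProjectionOnto x) = T x := by
  conv_rhs => rw [← coe_proj_add_coe_proj_orthogonal (V := V) x]
  rw [map_add, hT.apply_of_mem_orthogonal (Vᗮ.orthogonalProjectionOnto x).2, add_zero]

theorem isSelfAdjoint_opBlock (hT : KawashimaCondition V A T) : IsSelfAdjoint (opBlock V V T) := by
  rw [ContinuousLinearMap.isSelfAdjoint_iff_isSymmetric]
  intro v w
  have := (ContinuousLinearMap.isSelfAdjoint_iff_isSymmetric.1 hT.isSelfAdjoint) v w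
  simpa only [ContinuousLinearMap.coe_coe, Submodule.coe_inner, hT.coe_opBlock] using this

/-- Block elimination reduces the pencil `(A, T)` to the pencil `(Ã, T₂₂)` on `V`. -/
def reduction (hT : KawashimaCondition V A T) (hA11 : IsUnit (opBlock Vᗮ Vᗮ A)) :
    PencilReduction A T (reducedOp V A) (opBlock V V T) where
  ι := slaveGraph V A
  π := V.orthogonalProjectionOnto
  j := V.subtypeL
  q := V.orthogonalProjectionOnto - ((opBlock Vᗮ V A).comp (Ring.inverse (opBlock Vᗮ Vᗮ A))).comp
    Vᗮ.orthogonalProjectionOnto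
  π_ι := proj_slaveGraph
  Γ_ι v := apply_slaveGraph hA11 v
  E_ι v := by
    rw [slaveGraph_apply, map_add, hT.apply_of_mem_orthogonal (slaveOp V A v).2, add_zero]
    exact (hT.coe_opBlock v).symm
  q_Γ x := by
    have h1 := DFunLike.congr_fun (Ring.inverse_mul_cancel _ hA11) (Vᗮ.orthogonalProjectionOnto x)
    change Ring.inverse (opBlock Vᗮ Vᗮ A) (opBlock Vᗮ Vᗮ A (Vᗮ.orthogonalProjectionOnto x)) =
      Vᗮ.orthogonalProjectionOnto x at h1
    conv_lhs => rw [← coe_proj_add_coe_proj_orthogonal (V := V) x]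
    simp only [_root_.sub_apply, ContinuousLinearMap.comp_apply, map_add, ← coe_opBlock_apply, h1,
      reducedOp]
    abel
  q_E x := by
    have h1 : Vᗮ.orthogonalProjectionOnto (T x) = 0 :=
      Submodule.orthogonalProjectionOnto_apply_of_mem_orthogonal
        (by rw [V.orthogonal_orthogonal]; exact hT.apply_mem x)
    rw [_root_.sub_apply, ContinuousLinearMap.comp_apply, h1, map_zero, sub_zero,
      coe_opBlock_apply, hT.apply_proj]
  E_ι_π x := by
    rw [slaveGraph_apply, map_add, hT.apply_of_mem_orthogonal (slaveOp V A _).2, add_zero,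
      hT.apply_proj]

/-- The centre projection of the reduction has range `Vᗮ`. -/
theorem range_id_sub (hT : KawashimaCondition V A T) (hA11 : IsUnit (opBlock Vᗮ Vᗮ A)) :
    LinearMap.range ((ContinuousLinearMap.id ℂ H - (hT.reduction hA11).ι.comp
      (hT.reduction hA11).π : H →L[ℂ] H) : H →ₗ[ℂ] H) = Vᗮ := by
  have hι : (hT.reduction hA11).ι = slaveGraph V A := rfl
  have hπ : (hT.reduction hA11).π = V.orthogonalProjectionOnto := rfl
  have hker : ∀ x, x ∈ Vᗮ ↔ V.orthogonalProjectionOnto x = 0 := fun x =>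
    Submodule.orthogonalProjectionOnto_eq_zero_iff.symm
  ext x
  rw [hker, hι, hπ]
  constructor
  · rintro ⟨x, rfl⟩
    simp [proj_slaveGraph]
  · intro hx
    exact ⟨x, by simp [hx]⟩

end KawashimaCondition

/-- What one equilibrium contributes: the reduced bi-semigroup, the trichotomy of the full
equation, and the uniqueness of its mild solutions. -/
theorem KawashimaCondition.exists_isTrichotomy (hT : KawashimaCondition V A T)
    (hA : IsSelfAdjoint A) (hinj : Function.Injective A) (hA11 : IsUnit (opBlock Vᗮ Vᗮ A)) :
    (∃ b : BiSemigroup V, b.IsGeneratedBy (invMulOp (reducedOp V A) (opBlock V V T)) ∧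
      b.ExpStable) ∧ MildUnique A T ∧
    ∃ (Pc P P' : H →L[ℂ] H) (ν : ℝ) (U U' : ℝ → H →L[ℂ] H), 0 < ν ∧
      LinearMap.range (Pc : H →ₗ[ℂ] H) = Vᗮ ∧ IsTrichotomy A T Pc P P' ν U U' := by
  obtain ⟨δ, hδ, hneg⟩ := hT.negative
  have hinj' := injective_reducedOp (V := V) hA11 hinj
  obtain ⟨hu, P, P', ν, U, U', hν, hsum, h, h'⟩ := exists_dichotomy_of_negative
    (isSelfAdjoint_reducedOp hA hA11) hinj' hT.isSelfAdjoint_opBlock hδ (fun v => by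
      rw [Submodule.coe_inner, hT.coe_opBlock]; exact hneg v v.2)
  exact ⟨exists_biSemigroup hinj' hν h h' hsum, (hT.reduction hA11).mildUnique hinj hu,
    _, _, _, ν, _, _, hν, hT.range_id_sub hA11, (hT.reduction hA11).isTrichotomy hinj h h' hsum⟩

end Blocks

end

theorem theorem1p2 {H : Type*} [NormedAddCommGroup H] [InnerProductSpace ℂ H] [CompleteSpace H]
    -- the operator `A`, the subspace `V` and the bilinear map `B`
    (A : H →L[ℂ] H) (hA : IsSelfAdjoint A)
    (V : Submodule ℂ H) [CompleteSpace V] (hV : V ≠ ⊤) (hVfin : FiniteDimensional ℂ Vᗮ)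
    (B : H →L[ℂ] H →L[ℂ] V) (hB : ∀ u w : H, B u w = B w u)
    -- the two equilibria
    (uplus uminus : H) (hQplus : quadMap B uplus = 0) (hQminus : quadMap B uminus = 0)
    (hKplus : KawashimaCondition V A (fderiv ℂ (quadMap B) uplus))
    (hKminus : KawashimaCondition V A (fderiv ℂ (quadMap B) uminus))
    -- `A` is one-to-one
    (hAinj : Function.Injective A)
    -- the compression of `A` to `Vᗮ` is invertible
    (hA11 : IsUnit (opBlock Vᗮ Vᗮ A)) :
    -- the shifted equation, for all small positive `η`
    (∃ ηstar : ℝ, 0 < ηstar ∧ ∀ η : ℝ, 0 < η → η < ηstar →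
      (∃ b : BiSemigroup H,
        b.IsGeneratedBy (invMulOp A (fderiv ℂ (quadMap B) uplus + (η : ℂ) • A)) ∧ b.ExpStable) ∧
      (∃ b : BiSemigroup H,
        b.IsGeneratedBy (invMulOp A (fderiv ℂ (quadMap B) uminus - (η : ℂ) • A)) ∧ b.ExpStable) ∧
      HasExponentialDichotomy A (fderiv ℂ (quadMap B) uplus + (η : ℂ) • A) ∧
      HasExponentialDichotomy A (fderiv ℂ (quadMap B) uminus - (η : ℂ) • A)) ∧
    -- the reduced equation on `V`
    Function.Injective (reducedOp V A) ∧
    (∃ b : BiSemigroup V,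
      b.IsGeneratedBy
        (invMulOp (reducedOp V A) (opBlock V V (fderiv ℂ (quadMap B) uplus))) ∧ b.ExpStable) ∧
    (∃ b : BiSemigroup V,
      b.IsGeneratedBy
        (invMulOp (reducedOp V A) (opBlock V V (fderiv ℂ (quadMap B) uminus))) ∧ b.ExpStable) ∧
    -- the decomposition of `H`
    HasCenterStableUnstableDecomposition A (fderiv ℂ (quadMap B) uplus) Vᗮ ∧
    HasCenterStableUnstableDecomposition A (fderiv ℂ (quadMap B) uminus) Vᗮ := by
  obtain ⟨hb, hu, Pc, P, P', ν, U, U', hν, hPc, htri⟩ :=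
    hKplus.exists_isTrichotomy hA hAinj hA11
  obtain ⟨hb₂, hu₂, Pc₂, P₂, P₂', ν₂, U₂, U₂', hν₂, hPc₂, htri₂⟩ :=
    hKminus.exists_isTrichotomy hA hAinj hA11
  refine ⟨⟨min ν ν₂, lt_min hν hν₂, fun η hη hη' => ?_⟩, injective_reducedOp hA11 hAinj, hb, hb₂,
    hPc ▸ htri.hasCenterStableUnstableDecomposition hu hν,
    hPc₂ ▸ htri₂.hasCenterStableUnstableDecomposition hu₂ hν₂⟩
  have h := htri.shift_add hAinj hu hη (hη'.trans_le (min_le_left _ _))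
  have h₂ := htri₂.shift_sub hAinj hu₂ hη (hη'.trans_le (min_le_right _ _))
  exact ⟨h.1, h₂.1, h.2, h₂.2⟩
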